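/- **Setting.** Let $1\le n\le L$. A controllable and observable system $x_{k+1}=Ax_k+Bu_k$, $y_k=Cx_k+Du_k$ with $x_k\in\mathbb R^n$, $u_k\in\mathbb R^m$, $y_k\in\mathbb R^p$ generates noiseless data $u^d,x^d,y^d$. The input samples $u^d_0,\dots,u^d_{N-1}$ are persistently exciting of order $L+2n$, i.e. the Hankel matrix $H_{L+2n}(u^d)$ with $L+2n$ block rows has rank $m(L+2n)$. Let $\mathbb U\subseteq\mathbb R^m$, $\mathbb Y\subseteq\mathbb R^p$ be closed and convex (e.g. polytopic), $Q\succeq0$, $R\succ0$, $\|v\|_W^2=v'Wv$. Let $\chi_0=(u_{[t-n,t-1]},y_{[t-n,t-1]})$ be the last $n$ inputs and outputs of the plant before the prediction, and $x_t$ its current state. *Relaxed data-driven problem*, for a square weight matrix $P$ and $\rho_\alpha\ge 0$: $$\min_{\alpha,\bar u,\bar y}\ \sum_{k=0}^{L-1}\left[\|\bar y_k\|_Q^2+\|\bar u_k\|_R^2\right]+\left\|\begin{bmatrix}\bar u_{[L-n,L-1]}\\ \bar y_{[L-n,L-1]}\end{bmatrix}\right\|_P^2+\rho_\alpha\|\alpha\|^2$$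 subject to $$\begin{bmatrix}\bar u_{[-n,L-1]}\\ \bar y_{[-n,L-1]}\end{bmatrix}=\begin{bmatrix}H_{L+n}(u^d)\\ H_{L+n}(y^d)\end{bmatrix}\alpha,\qquad \begin{bmatrix}\bar u_{[-n,-1]}\\ \bar y_{[-n,-1]}\end{bmatrix}=\chi_0,\qquad \bar u_k\in\mathbb U,\ \bar y_k\in\mathbb Y\ \ (0\le k\le L-1),$$ where the Hankel matrices are built from the first $N$ samples. *E-DDPC problem*, for a state data sequence $\xi^d$, an initial state $\xi$ and a set $\mathbb X$: $$\min_{\bar u_{[0,L-1]}}\ \sum_{k=0}^{L-1}\left[\|\bar \xi_k\|_{\tilde Q}^2+\|\bar u_k\|_{\tilde R}^2\right]+\|\bar \xi_L\|_{\tilde P}^2\quad\text{s.t. } \bar \xi_{k+1}=X_1 M^{\dagger}\begin{bmatrix}\bar u_k\\ \bar \xi_k\end{bmatrix},\ \ \bar \xi_0=\xi,\ \ \bar u_k\in\mathbb U\ (0\le k\le L-1),\ \ \bar\xi_k\in\mathbb X,$$ where $M$ has the columns $\begin{bmatrix}u^d_k\\ \xi^d_k\end{bmatrix}$, $k=n,\dots,n+N_1-1$,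 $X_1$ has the columns $\xi^d_{k+1}$ for the same $k$, $N_1\ge N-n$ (in particular $N_1=N$), the data being a trajectory over $0,\dots,n+N_1-1$; $M^\dagger$ is any matrix with $MM^\dagger M=M$ (a right inverse if $M$ has full row rank; for instance the Moore–Penrose inverse). **Theorem.** The E-DDPC problem and the relaxed problem are equivalent as $\rho_\alpha\to0^+$ in the following two cases. (i) *The state is fully measured* ($y=x$, i.e. $C=I$, $D=0$): $\xi^d=x^d$, $\xi=x_t$, $\mathbb X=\mathbb Y$ imposed for $0\le k\le L-1$, and $\tilde Q=Q$, $\tilde R=R$, $P=T'\tilde PT$, where $\tilde P$ is any $n\times n$ weight and $T$ is any matrix such that $x_k=T\begin{bmatrix}u_{[k-n,k-1]}\\ x_{[k-n,k-1]}\end{bmatrix}$ on the trajectories of the system. The decision variables correspond through $\bar u_k=\bar u_k$, $\bar\xi_k=\bar y_k$ $(k<L)$ and $\bar\xi_L=T\begin{bmatrix}\bar u_{[L-n,L-1]}\\ \bar y_{[L-n,L-1]}\end{bmatrix}$, and $c=0$ below. (ii) *Only inputs and outputs are measured*: the state is replaced by the non-minimal state $z_k=(u_{k-n},\dots,u_{k-1},y_{k-n},\dots,y_{k-1})$,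 i.e. $\xi^d=z^d$, $\xi=\chi_0$; $\mathbb X=\mathbb U^n\times\mathbb Y^n$ is imposed for $0\le k\le L$, and the past data satisfy the constraints, $\chi_0\in\mathbb U^n\times\mathbb Y^n$; and $$\tilde Q=V'\begin{bmatrix}R&0\\0&Q\end{bmatrix}V,\qquad \tilde R=0,\qquad \tilde P=P+\tilde Q,$$ where $P$ is any weight and $V$ is any matrix such that $\begin{bmatrix}u_{k-1}\\ y_{k-1}\end{bmatrix}=Vz_k$ on the trajectories of the system. The decision variables correspond through $\bar u_k=\bar u_k$ and $\bar\xi_k=\bar z_k$, the stack of $\bar u_{[k-n,k-1]}$ and $\bar y_{[k-n,k-1]}$ $(0\le k\le L)$, and $c=-\left(\|u_{t-1}\|_R^2+\|y_{t-1}\|_Q^2\right)$ below. Here *equivalent as $\rho_\alpha\to0^+$* means the following. 1. The correspondence maps the feasible set of the relaxed problem (which does not depend on $\rho_\alpha$) onto the feasible set of the E-DDPC problem. 2. At corresponding feasible points the relaxed cost equals the E-DDPC cost plus $c+\rho_\alpha\|\alpha\|^2$, where $c$ does not depend on the decision variables. 3. The minimizers of the relaxed problem with $\rho_\alpha=0$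 correspond exactly to the minimizers of the E-DDPC problem. 4. As $\rho_\alpha\to0^+$, the optimal value of the relaxed problem converges, in $[-\infty,+\infty]$, to the optimal value of the E-DDPC problem plus $c$. 5. If the terminal weight ($\tilde P$ in case (i), $P$ in case (ii)) is positive semidefinite and the problems are feasible, then the E-DDPC problem has exactly one minimizer, the relaxed problem has exactly one for each $\rho_\alpha>0$, and the E-DDPC variables corresponding to the latter converge to the former as $\rho_\alpha\to0^+$. -/

import Mathlib

open Filter Topology

/-- The weighted square `‖v‖²_W = v' W v`. -/
def wsq {ι : Type*} [Fintype ι] (W : Matrix ι ι ℝ) (v : ι → ℝ) : ℝ :=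
  v ⬝ᵥ W.mulVec v

/-- Matrices of the state-space system `x⁺ = A x + B u`, `y = C x + D u`
with `n` states, `m` inputs and `p` outputs. -/
structure LTISystem (n m p : ℕ) where
  A : Matrix (Fin n) (Fin n) ℝ
  B : Matrix (Fin n) (Fin m) ℝ
  C : Matrix (Fin p) (Fin n) ℝ
  D : Matrix (Fin p) (Fin m) ℝ

namespace LTISystem

variable {n m p : ℕ}

/-- The controllability matrix `[B, AB, …, Aⁿ⁻¹B]` has rank `n`. -/
def Controllable (S : LTISystem n m p) : Prop :=
  (Matrix.of fun (i : Fin n) (j : Fin n × Fin m) => (S.A ^ (j.1 : ℕ) * S.B) i j.2).rank = n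

/-- The observability matrix with block rows `C, CA, …, CAⁿ⁻¹` has rank `n`. -/
def Observable (S : LTISystem n m p) : Prop :=
  (Matrix.of fun (i : Fin n × Fin p) (j : Fin n) => (S.C * S.A ^ (i.1 : ℕ)) i.2 j).rank = n

/-- `u_0, …, u_{K-1}`, `x_0, …, x_K`, `y_0, …, y_{K-1}` is a trajectory of length `K`
(values of the three sequences at later times are irrelevant). -/
def IsTrajectory (S : LTISystem n m p) (K : ℕ) (u : ℕ → Fin m → ℝ) (x : ℕ → Fin n → ℝ)
    (y : ℕ → Fin p → ℝ) : Prop :=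
  ∀ k < K, x (k + 1) = S.A.mulVec (x k) + S.B.mulVec (u k) ∧
    y k = S.C.mulVec (x k) + S.D.mulVec (u k)

end LTISystem

/-- The Hankel matrix with `K` block rows of `w_0, …, w_{N-1}`; it has `N - K + 1` columns. -/
def hankel {q : ℕ} (N K : ℕ) (w : ℕ → Fin q → ℝ) :
    Matrix (Fin K × Fin q) (Fin (N + 1 - K)) ℝ :=
  Matrix.of fun r j => w (r.1 + j) r.2

/-- `w_0, …, w_{N-1}` is persistently exciting of order `K`. -/
def PersistentlyExciting {q : ℕ} (N K : ℕ) (w : ℕ → Fin q → ℝ) : Prop :=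
  (hankel N K w).rank = q * K

/-- Index type of a stack of `n` inputs followed by `n` outputs. -/
abbrev IOIndex (n m p : ℕ) : Type := (Fin n × Fin m) ⊕ (Fin n × Fin p)

/-- The vector stacking `u_0, …, u_{n-1}, y_0, …, y_{n-1}`. -/
def stack {n m p : ℕ} (u : Fin n → Fin m → ℝ) (y : Fin n → Fin p → ℝ) :
    IOIndex n m p → ℝ :=
  Sum.elim (fun r => u r.1 r.2) (fun r => y r.1 r.2)

/-- The stack of `u_{k-n}, …, u_{k-1}, y_{k-n}, …, y_{k-1}` of infinite sequences, for `n ≤ k`. -/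
def pastStack {m p : ℕ} (n : ℕ) (u : ℕ → Fin m → ℝ) (y : ℕ → Fin p → ℝ) (k : ℕ) :
    IOIndex n m p → ℝ :=
  stack (fun i => u (k - n + i)) (fun i => y (k - n + i))

/-- For a sequence over the times `-n, …, L-1` (time `t` is stored at position `n + t`), the window
over the times `k-n, …, k-1`. -/
def window {n L : ℕ} {β : Type*} (w : Fin (n + L) → β) (k : Fin (L + 1)) : Fin n → β :=
  fun i => w ⟨k + i, by omega⟩

/-- For a sequence over the times `-n, …, L-1`, its part over the times `0, …, L-1`. -/
def future {n L : ℕ} {β : Type*} (w : Fin (n + L) → β) : Fin L → β :=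
  fun k => w (Fin.natAdd n k)

/-! ### The relaxed data-driven problem -/

/-- Decision variables `(α, ū_{[-n,L-1]}, ȳ_{[-n,L-1]})`. -/
abbrev RelaxedVar (n m p L N : ℕ) : Type :=
  (Fin (N + 1 - (n + L)) → ℝ) × (Fin (n + L) → Fin m → ℝ) × (Fin (n + L) → Fin p → ℝ)

/-- Feasible set of the relaxed problem for the data `ud, yd`, the initial condition `χ₀` and the
value constraints `ū_k ∈ U`, `ȳ_k ∈ Y`, `k = 0, …, L-1`. -/
def relaxedFeasible {n m p L : ℕ} (N : ℕ) (ud : ℕ → Fin m → ℝ) (yd : ℕ → Fin p → ℝ)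
    (χ₀ : IOIndex n m p → ℝ) (U : Set (Fin m → ℝ)) (Y : Set (Fin p → ℝ)) :
    Set (RelaxedVar n m p L N) :=
  {d | (∀ j i, d.2.1 j i = (hankel N (n + L) ud).mulVec d.1 (j, i)) ∧
    (∀ j i, d.2.2 j i = (hankel N (n + L) yd).mulVec d.1 (j, i)) ∧
    stack (window d.2.1 0) (window d.2.2 0) = χ₀ ∧
    ∀ k : Fin L, future d.2.1 k ∈ U ∧ future d.2.2 k ∈ Y}

/-- Cost of the relaxed problem with regularization parameter `ρ`. -/
def relaxedCost {n m p L N : ℕ} (Q : Matrix (Fin p) (Fin p) ℝ) (R : Matrix (Fin m) (Fin m) ℝ)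
    (P : Matrix (IOIndex n m p) (IOIndex n m p) ℝ) (ρ : ℝ) (d : RelaxedVar n m p L N) : ℝ :=
  ∑ k : Fin L, (wsq Q (future d.2.2 k) + wsq R (future d.2.1 k)) +
    wsq P (stack (window d.2.1 (Fin.last L)) (window d.2.2 (Fin.last L))) +
    ρ * (d.1 ⬝ᵥ d.1)

/-! ### The state-based problem E-DDPC, for a state with index type `σ` -/

/-- Decision variables `ū_{[0,L-1]}`, with the predicted states `x̄_0, …, x̄_L` that they determine. -/
abbrev EDDPCVar (m L : ℕ) (σ : Type) : Type :=
  (Fin L → Fin m → ℝ) × (Fin (L + 1) → σ → ℝ)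

/-- The data matrix with the columns `(u_k, x_k)`, `k = n, …, n + N₁ - 1`. -/
def dataMatrix {m : ℕ} {σ : Type} (n N₁ : ℕ) (ud : ℕ → Fin m → ℝ) (xd : ℕ → σ → ℝ) :
    Matrix (Fin m ⊕ σ) (Fin N₁) ℝ :=
  Matrix.fromRows (Matrix.of fun i j => ud (n + j) i) (Matrix.of fun i j => xd (n + j) i)

/-- The data matrix with the columns `x_k`, `k = n + 1, …, n + N₁`. -/
def shiftedStates {σ : Type} (n N₁ : ℕ) (xd : ℕ → σ → ℝ) : Matrix σ (Fin N₁) ℝ :=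
  Matrix.of fun i j => xd (n + j + 1) i

/-- `G` is a generalized inverse of `M`. If `M` has full row rank this says exactly that `G` is a
right inverse of `M`; the Moore-Penrose pseudo-inverse always has this property. -/
def IsGenInverse {ι κ : Type*} [Fintype ι] [Fintype κ] (M : Matrix ι κ ℝ) (G : Matrix κ ι ℝ) :
    Prop :=
  M * G * M = M

/-- Feasible set of E-DDPC: the prediction model `x̄_{k+1} = X₁ G (ū_k, x̄_k)`, the initial condition
`x̄_0 = x`, and the constraints `ū_k ∈ U` for `k = 0, …, L-1` and `x̄_k ∈ X` for `k = 0, …, s-1`. -/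
def eddpcFeasible {m L N₁ : ℕ} {σ : Type} [Fintype σ] (X₁ : Matrix σ (Fin N₁) ℝ)
    (G : Matrix (Fin N₁) (Fin m ⊕ σ) ℝ) (x : σ → ℝ) (U : Set (Fin m → ℝ)) (X : Set (σ → ℝ))
    (s : ℕ) : Set (EDDPCVar m L σ) :=
  {e | (∀ k : Fin L, e.2 k.succ = (X₁ * G).mulVec (Sum.elim (e.1 k) (e.2 k.castSucc))) ∧
    e.2 0 = x ∧ (∀ k : Fin L, e.1 k ∈ U) ∧ ∀ k : Fin (L + 1), (k : ℕ) < s → e.2 k ∈ X}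

/-- Cost of E-DDPC. -/
def eddpcCost {m L : ℕ} {σ : Type} [Fintype σ] (Q : Matrix σ σ ℝ) (R : Matrix (Fin m) (Fin m) ℝ)
    (P : Matrix σ σ ℝ) (e : EDDPCVar m L σ) : ℝ :=
  ∑ k : Fin L, (wsq Q (e.2 k.castSucc) + wsq R (e.1 k)) + wsq P (e.2 (Fin.last L))

/-- The set `Uⁿ × Yⁿ` of stacks of `n` admissible inputs and `n` admissible outputs. -/
def stackSet {m p : ℕ} (n : ℕ) (U : Set (Fin m → ℝ)) (Y : Set (Fin p → ℝ)) :
    Set (IOIndex n m p → ℝ) :=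
  {z | (∀ i, (fun j => z (Sum.inl (i, j))) ∈ U) ∧ ∀ i, (fun j => z (Sum.inr (i, j))) ∈ Y}

/-! ### Correspondence of the decision variables -/

/-- Measured state: `x̄_k = ȳ_k` for `k < L`, and `x̄_L` is recovered from the last `n` predicted
inputs and states through `T`. -/
def toMeasured {n m L N : ℕ} (T : Matrix (Fin n) (IOIndex n m n) ℝ) (d : RelaxedVar n m n L N) :
    EDDPCVar m L (Fin n) :=
  (future d.2.1, Fin.snoc (α := fun _ => Fin n → ℝ) (future d.2.2)
    (T.mulVec (stack (window d.2.1 (Fin.last L)) (window d.2.2 (Fin.last L)))))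

/-- Output only: `z̄_k` stacks the inputs and outputs over the times `k-n, …, k-1`. -/
def toNonminimal {n m p L N : ℕ} (d : RelaxedVar n m p L N) : EDDPCVar m L (IOIndex n m p) :=
  (future d.2.1, fun k => stack (window d.2.1 k) (window d.2.2 k))

/-! ### Equivalence of optimization problems -/

/-- The set of minimizers of `J` over `F`. -/
def argminSet {D : Type*} (F : Set D) (J : D → ℝ) : Set D :=
  {d | d ∈ F ∧ IsMinOn J F d}

/-- The problems `min_F J ρ`, where `J ρ = J 0 + ρ r`, become equivalent to `min_F' J'` as `ρ → 0`,
through the map `Φ` of the decision variables and up to the constant `c` in the cost: `Φ` maps the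
feasible set onto the feasible set, the costs agree up to `c` and `ρ r`, the minimizers for `ρ = 0`
correspond, and the optimal value (possibly infinite) converges as `ρ` decreases to `0`. -/
def VanishingEquivalent {D E : Type*} (F : Set D) (J : ℝ → D → ℝ) (r : D → ℝ)
    (F' : Set E) (J' : E → ℝ) (Φ : D → E) (c : ℝ) : Prop :=
  Φ '' F = F' ∧
  (∀ ρ : ℝ, ∀ d ∈ F, J ρ d = J' (Φ d) + c + ρ * r d) ∧
  Φ '' argminSet F (J 0) = argminSet F' J' ∧
  Tendsto (fun ρ : ℝ => ⨅ d ∈ F, ((J ρ d : ℝ) : EReal)) (𝓝[>] 0)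
    (𝓝 (⨅ e ∈ F', ((J' e + c : ℝ) : EReal)))

/-- If the limit problem is feasible, it has exactly one minimizer, so does each regularized problem
with `ρ > 0`, and the latter minimizers converge to the former as `ρ` decreases to `0`. -/
def MinimizersConverge {D E : Type*} [TopologicalSpace E] (F : Set D) (J : ℝ → D → ℝ)
    (F' : Set E) (J' : E → ℝ) (Φ : D → E) : Prop :=
  F'.Nonempty → ∃ (d : ℝ → D) (e : E), (∀ ρ > 0, argminSet F (J ρ) = {d ρ}) ∧
    argminSet F' J' = {e} ∧ Tendsto (fun ρ => Φ (d ρ)) (𝓝[>] 0) (𝓝 e)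

/-!
Both problems optimize over the same objects, the trajectories of length `n + L` that continue the
past one (`LTISystem.Prolongs`).

For the relaxed problem this is Willems' fundamental lemma, `exists_delayComb_eq`: the matrix with
the columns `(u_j, …, u_{j+K-1}, x_j)` has full row rank. A left kernel vector `(η, ξ)` gives
relations at the times `j, …, j + n`, and the combination of these with the coefficients of the
characteristic polynomial of `A` contains no state any more. By persistency of excitation its
coefficients vanish. As the polynomial is monic, this convolution forces `η = 0` and
`ξ Aᵏ B = 0` for `k < n`, one coefficient after the other, and controllability gives `ξ = 0`.
Observability makes the past inputs and outputs fix the state from which the prediction starts.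

For E-DDPC the data matrix `M` need not have full row rank, since the stacks of inputs and outputs
of the system in general span a proper subspace. But `ker M ⊆ ker X₁`, because the data of a
combination of columns determine its next state, and so `X₁ M†` predicts correctly on the range of
`M` (`shiftedStates_mul_mulVec`). Every trajectory of the system stays in this range, again by the
fundamental lemma.

The correspondence is therefore onto, and the costs are compared term by term; with outputs only,
the stage cost of `z_k` is that of the input and output at time `k - 1`. The statements on
minimizers for `ρ = 0` and on optimal values are formal consequences
(`vanishingEquivalent_of_cost`). For semidefinite terminal weights both costs are quadratic forms
that are positive definite on the differences of feasible points: the relaxed one through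
`ρ ‖α‖²`, as `α` determines the other variables, the one of E-DDPC through `R`, as the inputs
determine the states. The parallelogram law then gives existence, uniqueness and a quadratic growth
bound, which turns convergence of the values into convergence of the minimizers
(`minimizersConverge_of_quadratic`).
-/

/-! ### Vanishing regularization and quadratic forms -/

/-- The correspondence of the feasible sets and of the costs implies the rest of the equivalence.
For the limit of the values, every feasible `d` gives the upper bound `J' (Φ d) + c`. -/
theorem vanishingEquivalent_of_cost {D E : Type*} {F : Set D} {J : ℝ → D → ℝ} {r : D → ℝ}
    {F' : Set E} {J' : E → ℝ} {Φ : D → E} {c : ℝ} (hΦ : Φ '' F = F')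
    (hJ : ∀ ρ : ℝ, ∀ d ∈ F, J ρ d = J' (Φ d) + c + ρ * r d) (hr : ∀ d ∈ F, 0 ≤ r d) :
    VanishingEquivalent F J r F' J' Φ c := by
  subst hΦ
  refine ⟨rfl, hJ, ?_, ?_⟩
  · ext e
    constructor
    · rintro ⟨d, ⟨hd, hmin⟩, rfl⟩
      refine ⟨⟨d, hd, rfl⟩, ?_⟩
      rintro _ ⟨d', hd', rfl⟩
      have h : J 0 d ≤ J 0 d' := hmin hd'
      rw [hJ 0 d hd, hJ 0 d' hd'] at h
      show J' (Φ d) ≤ J' (Φ d')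
      linarith
    · rintro ⟨⟨d, hd, rfl⟩, hmin⟩
      refine ⟨d, ⟨hd, fun d' hd' => ?_⟩, rfl⟩
      have h : J' (Φ d) ≤ J' (Φ d') := hmin ⟨d', hd', rfl⟩
      show J 0 d ≤ J 0 d'
      rw [hJ 0 d hd, hJ 0 d' hd']
      linarith
  · rw [tendsto_order]
    constructor
    · intro a ha
      filter_upwards [self_mem_nhdsWithin] with ρ (hρ : 0 < ρ)
      refine ha.trans_le (le_iInf₂ fun d hd => (iInf₂_le (Φ d) ⟨d, hd, rfl⟩).trans ?_)
      rw [EReal.coe_le_coe_iff, hJ ρ d hd]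
      have := mul_nonneg hρ.le (hr d hd)
      linarith
    · intro b hb
      obtain ⟨_, ⟨d, hd, rfl⟩, hdb⟩ : ∃ e, ∃ _ : e ∈ Φ '' F, ((J' e + c : ℝ) : EReal) < b := by
        simpa only [iInf_lt_iff] using hb
      have hlim : Tendsto (fun ρ : ℝ => ((J' (Φ d) + c + ρ * r d : ℝ) : EReal)) (𝓝[>] 0)
          (𝓝 ((J' (Φ d) + c : ℝ) : EReal)) := by
        refine (continuous_coe_real_ereal.tendsto _).comp ?_
        have : Continuous fun ρ : ℝ => J' (Φ d) + c + ρ * r d := by fun_prop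
        simpa using (this.tendsto 0).mono_left nhdsWithin_le_nhds
      filter_upwards [hlim.eventually_lt_const hdb] with ρ hρ
      refine (iInf₂_le d hd).trans_lt ?_
      rwa [hJ ρ d hd]

namespace QuadraticMap

variable {E : Type*} [NormedAddCommGroup E] [NormedSpace ℝ E]

theorem map_midpoint_real (q : QuadraticForm ℝ E) (a b : E) :
    q ((1 / 2 : ℝ) • a + (1 / 2 : ℝ) • b) = (q a + q b) / 2 - q (a - b) / 4 := by
  have h := map_add_self q a
  have h1 : q (a - b) = q a + q b - polar q a b := by
    rw [sub_eq_add_neg, QuadraticMap.map_add q a (-b), QuadraticMap.map_neg, polar_neg_right]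
    ring
  rw [← smul_add, QuadraticMap.map_smul, QuadraticMap.map_add q a b, h1, smul_eq_mul]
  ring

/-- Compactness of the unit sphere of `W` gives the lower bound. -/
theorem exists_pos_mul_norm_sq_le [FiniteDimensional ℝ E] (q : QuadraticForm ℝ E)
    (hq : Continuous q) (W : Submodule ℝ E) (hW : ∀ v ∈ W, v ≠ 0 → 0 < q v) :
    ∃ κ > 0, ∀ v ∈ W, κ * ‖v‖ ^ 2 ≤ q v := by
  have : ProperSpace E := FiniteDimensional.proper ℝ E
  have hcomp : IsCompact (Metric.sphere (0 : E) 1 ∩ W) :=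
    (isCompact_sphere 0 1).inter_right W.closed_of_finiteDimensional
  obtain ⟨κ, hκ, hle⟩ : ∃ κ > 0, ∀ v ∈ Metric.sphere (0 : E) 1 ∩ W, κ ≤ q v := by
    rcases (Metric.sphere (0 : E) 1 ∩ W).eq_empty_or_nonempty with h | h
    · exact ⟨1, one_pos, by simp [h]⟩
    · obtain ⟨v, hv, hmin⟩ := hcomp.exists_isMinOn h hq.continuousOn
      refine ⟨q v, hW v hv.2 ?_, fun w hw => hmin hw⟩
      rintro rfl
      simpa using hv.1
  refine ⟨κ, hκ, fun v hv => ?_⟩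
  rcases eq_or_ne v 0 with rfl | hv0
  · simp
  have hn : 0 < ‖v‖ := norm_pos_iff.2 hv0
  have h := hle (‖v‖⁻¹ • v) ⟨by simp [norm_smul, hn.ne'], W.smul_mem _ hv⟩
  rw [QuadraticMap.map_smul, smul_eq_mul] at h
  calc κ * ‖v‖ ^ 2 ≤ (‖v‖⁻¹ * ‖v‖⁻¹ * q v) * ‖v‖ ^ 2 := by gcongr
    _ = q v := by field_simp

/-- Only the differences of points of `F` have to lie where `q` is definite. The growth bound at the
minimizer comes from comparison with the midpoint, through the parallelogram law. -/
theorem exists_argminSet_eq_singleton [FiniteDimensional ℝ E] (q : QuadraticForm ℝ E)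
    (hq : Continuous q) (hq0 : ∀ v, 0 ≤ q v) (W : Submodule ℝ E) (hW : ∀ v ∈ W, v ≠ 0 → 0 < q v)
    {F : Set E} (hF : IsClosed F) (hconv : Convex ℝ F) (hne : F.Nonempty)
    (hFW : ∀ a ∈ F, ∀ b ∈ F, a - b ∈ W) :
    ∃ e, argminSet F q = {e} ∧ ∃ κ > 0, ∀ d ∈ F, κ * ‖d - e‖ ^ 2 ≤ q d - q e := by
  have : ProperSpace E := FiniteDimensional.proper ℝ E
  obtain ⟨κ, hκ, hle⟩ := exists_pos_mul_norm_sq_le q hq W hW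
  obtain ⟨a, ha⟩ := hne
  have hmid : ∀ x ∈ F, ∀ y ∈ F, (1 / 2 : ℝ) • x + (1 / 2 : ℝ) • y ∈ F := fun x hx y hy =>
    hconv hx hy (by norm_num) (by norm_num) (by norm_num)
  obtain ⟨e, he, hmin⟩ : ∃ e ∈ F, IsMinOn q F e := by
    -- `q x ≥ κ ‖x - a‖² / 2 - q a` on `F`, so that `q` is at least `q a` far from `a`.
    refine hq.continuousOn.exists_isMinOn' hF ha ?_
    rw [eventually_inf_principal]
    have h1 : Tendsto (fun x : E => ‖x - a‖) (cocompact E) atTop := by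
      refine tendsto_atTop_mono (fun x => norm_sub_norm_le x a) ?_
      exact tendsto_atTop_add_const_right _ _ tendsto_norm_cocompact_atTop
    have h2 := (tendsto_pow_atTop (two_ne_zero)).comp h1
    filter_upwards [h2.eventually_ge_atTop (4 * q a / κ)] with x hx hxF
    have h3 := hle _ (hFW x hxF a ha)
    have h4 : 4 * q a ≤ κ * ‖x - a‖ ^ 2 := by
      rw [div_le_iff₀ hκ] at hx
      simpa [mul_comm] using hx
    have h5 := map_midpoint_real q x a
    have h6 := hq0 ((1 / 2 : ℝ) • x + (1 / 2 : ℝ) • a)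
    linarith
  have hkey : ∀ d ∈ F, κ / 2 * ‖d - e‖ ^ 2 ≤ q d - q e := by
    intro d hd
    have h1 : q e ≤ q ((1 / 2 : ℝ) • d + (1 / 2 : ℝ) • e) := hmin (hmid d hd e he)
    rw [map_midpoint_real] at h1
    have h2 := hle _ (hFW d hd e he)
    linarith
  refine ⟨e, ?_, κ / 2, by positivity, hkey⟩
  ext d
  refine ⟨fun ⟨hd, hd'⟩ => ?_, fun h => h ▸ ⟨he, hmin⟩⟩
  have h1 := hkey d hd
  have h2 : q d ≤ q e := hd' he
  have h3 : ‖d - e‖ ^ 2 ≤ 0 := by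
    by_contra! h
    have : 0 < κ / 2 * ‖d - e‖ ^ 2 := by positivity
    linarith
  have h4 : ‖d - e‖ = 0 := by nlinarith [norm_nonneg (d - e)]
  exact sub_eq_zero.1 (norm_eq_zero.1 h4)

end QuadraticMap

/-- If `d₀` corresponds to the minimizer of `q'`, then comparison with `d₀` shows that the value of
`q'` at the point corresponding to the regularized minimizer exceeds the minimum by at most
`ρ r(d₀)`, and the growth bound of `q'` applies. -/
theorem minimizersConverge_of_quadratic {D E : Type*}
    [NormedAddCommGroup D] [NormedSpace ℝ D] [FiniteDimensional ℝ D]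
    [NormedAddCommGroup E] [NormedSpace ℝ E] [FiniteDimensional ℝ E]
    {F : Set D} {J : ℝ → D → ℝ} {r : D → ℝ} {F' : Set E} {Φ : D → E} {c : ℝ}
    (q : ℝ → QuadraticForm ℝ D) (hqJ : ∀ ρ, ⇑(q ρ) = J ρ) (q' : QuadraticForm ℝ E)
    (hΦ : Φ '' F = F')
    (hJ : ∀ ρ : ℝ, ∀ d ∈ F, J ρ d = q' (Φ d) + c + ρ * r d) (hr : ∀ d ∈ F, 0 ≤ r d)
    (hq : ∀ ρ, Continuous (q ρ)) (hq0 : ∀ ρ > 0, ∀ v, 0 ≤ q ρ v) (W : Submodule ℝ D)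
    (hW : ∀ ρ > 0, ∀ v ∈ W, v ≠ 0 → 0 < q ρ v)
    (hF : IsClosed F) (hconv : Convex ℝ F) (hFW : ∀ a ∈ F, ∀ b ∈ F, a - b ∈ W)
    (hq' : Continuous q') (hq'0 : ∀ v, 0 ≤ q' v) (W' : Submodule ℝ E)
    (hW' : ∀ v ∈ W', v ≠ 0 → 0 < q' v)
    (hF' : IsClosed F') (hconv' : Convex ℝ F') (hFW' : ∀ a ∈ F', ∀ b ∈ F', a - b ∈ W') :
    MinimizersConverge F J F' q' Φ := by
  intro hne'
  have hne : F.Nonempty := by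
    rw [← hΦ] at hne'
    exact hne'.of_image
  obtain ⟨e, he, κ, hκ, hbound⟩ :=
    q'.exists_argminSet_eq_singleton hq' hq'0 W' hW' hF' hconv' hne' hFW'
  have hd : ∀ ρ : ℝ, ∃ d, 0 < ρ → argminSet F (J ρ) = {d} := by
    intro ρ
    by_cases hρ : 0 < ρ
    · obtain ⟨d, hd, -⟩ :=
        (q ρ).exists_argminSet_eq_singleton (hq ρ) (hq0 ρ hρ) W (hW ρ hρ) hF hconv hne hFW
      exact ⟨d, fun _ => by rw [← hqJ, hd]⟩
    · exact ⟨hne.some, fun h => absurd h hρ⟩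
  choose d hd using hd
  refine ⟨d, e, hd, he, ?_⟩
  obtain ⟨heF', -⟩ : e ∈ argminSet F' q' := he ▸ rfl
  obtain ⟨d₀, hd₀, rfl⟩ : e ∈ Φ '' F := hΦ ▸ heF'
  have hsq : ∀ ρ > 0, ‖Φ (d ρ) - Φ d₀‖ ≤ √(ρ * r d₀ / κ) := by
    intro ρ hρ
    obtain ⟨hdF, hmin⟩ : d ρ ∈ argminSet F (J ρ) := hd ρ hρ ▸ rfl
    have h1 : J ρ (d ρ) ≤ J ρ d₀ := hmin hd₀
    rw [hJ ρ _ hdF, hJ ρ _ hd₀] at h1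
    have h2 := hbound (Φ (d ρ)) (hΦ ▸ ⟨d ρ, hdF, rfl⟩)
    have h3 := mul_nonneg hρ.le (hr _ hdF)
    refine Real.le_sqrt_of_sq_le ?_
    rw [le_div_iff₀ hκ]
    linarith
  rw [tendsto_iff_norm_sub_tendsto_zero]
  have hlim : Tendsto (fun ρ : ℝ => √(ρ * r d₀ / κ)) (𝓝[>] 0) (𝓝 0) := by
    have : Continuous fun ρ : ℝ => √(ρ * r d₀ / κ) := by fun_prop
    simpa using (this.tendsto 0).mono_left nhdsWithin_le_nhds
  refine squeeze_zero' (Eventually.of_forall fun _ => norm_nonneg _) ?_ hlim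
  filter_upwards [self_mem_nhdsWithin] with ρ hρ using hsq ρ hρ

/-! ### Trajectories and the fundamental lemma -/

namespace Matrix

variable {ι κ : Type*} [Fintype ι] [Fintype κ]

theorem rank_eq_card_iff_vecMul_eq_zero {M : Matrix ι κ ℝ} :
    M.rank = Fintype.card ι ↔ ∀ v, Matrix.vecMul v M = 0 → v = 0 := by
  have h := LinearMap.finrank_range_add_finrank_ker Mᵀ.mulVecLin
  rw [← Matrix.rank, rank_transpose, Module.finrank_fintype_fun_eq_card] at h
  have h0 : M.rank = Fintype.card ι ↔ Mᵀ.mulVecLin.ker = ⊥ := by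
    rw [← Submodule.finrank_eq_zero (R := ℝ)]
    omega
  rw [h0, LinearMap.ker_eq_bot']
  simp

theorem mulVec_surjective_of_vecMul_eq_zero {M : Matrix ι κ ℝ}
    (hM : ∀ v, Matrix.vecMul v M = 0 → v = 0) : Function.Surjective M.mulVec := by
  have h := rank_eq_card_iff_vecMul_eq_zero.2 hM
  have htop : M.mulVecLin.range = ⊤ := by
    apply Submodule.eq_top_of_finrank_eq
    rw [← Matrix.rank, h, Module.finrank_fintype_fun_eq_card]
  exact LinearMap.range_eq_top.1 htop

theorem eq_zero_of_mulVec_eq_zero_of_rank {M : Matrix ι κ ℝ} (hM : M.rank = Fintype.card κ)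
    {v : κ → ℝ} (hv : M.mulVec v = 0) : v = 0 := by
  rw [← rank_transpose] at hM
  exact rank_eq_card_iff_vecMul_eq_zero.1 hM v (by rwa [vecMul_transpose])

end Matrix

/-- The combination with coefficients `a` of the delayed sequences `w_{· + j}`. -/
def delayComb {M : ℕ} {ι : Type*} (a : Fin M → ℝ) (w : ℕ → ι → ℝ) (i : ℕ) : ι → ℝ :=
  ∑ j : Fin M, a j • w (i + j)

theorem hankel_mulVec {q N K : ℕ} (w : ℕ → Fin q → ℝ) (a : Fin (N + 1 - K) → ℝ) (j : Fin K)
    (i : Fin q) : (hankel N K w).mulVec a (j, i) = delayComb a w j i := by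
  simp [hankel, Matrix.mulVec, dotProduct, delayComb, mul_comm]

theorem delayComb_append_zero {M r : ℕ} {ι : Type*} (a : Fin M → ℝ) (w : ℕ → ι → ℝ) (i : ℕ) :
    delayComb (Fin.append a (0 : Fin r → ℝ)) w i = delayComb a w i := by
  simp [delayComb, Fin.sum_univ_add]

theorem delayComb_pastStack {n m p M : ℕ} (a : Fin M → ℝ) (u : ℕ → Fin m → ℝ)
    (y : ℕ → Fin p → ℝ) {k : ℕ} (hk : n ≤ k) :
    delayComb a (pastStack n u y) k = pastStack n (delayComb a u) (delayComb a y) k := by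
  have h : ∀ i j : ℕ, k + j - n + i = k - n + i + j := by omega
  ext (⟨i, l⟩ | ⟨i, l⟩) <;> simp [delayComb, pastStack, stack, h]

namespace LTISystem

variable {n m p : ℕ} {S : LTISystem n m p} {K K' : ℕ} {u u' : ℕ → Fin m → ℝ}
  {x x' : ℕ → Fin n → ℝ} {y y' : ℕ → Fin p → ℝ}

theorem IsTrajectory.mono (h : S.IsTrajectory K u x y) (hK : K' ≤ K) :
    S.IsTrajectory K' u x y :=
  fun k hk => h k (hk.trans_le hK)

theorem IsTrajectory.shift (h : S.IsTrajectory K u x y) {s : ℕ} (hK : s + K' ≤ K) :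
    S.IsTrajectory K' (fun k => u (s + k)) (fun k => x (s + k)) (fun k => y (s + k)) :=
  fun k hk => h (s + k) (by omega)

theorem isTrajectory_zero : S.IsTrajectory K 0 0 0 := fun k _ => by simp

theorem IsTrajectory.delayComb {M : ℕ} (h : S.IsTrajectory K u x y) (a : Fin M → ℝ)
    (hK : 0 < M → K' + M ≤ K + 1) :
    S.IsTrajectory K' (delayComb a u) (delayComb a x) (delayComb a y) := by
  intro k hk
  have hlt : ∀ j : Fin M, k + (j : ℕ) < K := fun j => by
    have := hK j.pos
    omega
  constructor
  · simp only [_root_.delayComb, Matrix.mulVec_sum, Matrix.mulVec_smul,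
      ← Finset.sum_add_distrib, ← smul_add]
    refine Finset.sum_congr rfl fun j _ => ?_
    rw [← (h _ (hlt j)).1, add_right_comm]
  · simp only [_root_.delayComb, Matrix.mulVec_sum, Matrix.mulVec_smul,
      ← Finset.sum_add_distrib, ← smul_add]
    exact Finset.sum_congr rfl fun j _ => by rw [← (h _ (hlt j)).2]

theorem IsTrajectory.state_eq (h : S.IsTrajectory K u x y) (h' : S.IsTrajectory K u' x' y')
    (hu : ∀ k < K, u k = u' k) (h0 : x 0 = x' 0) : ∀ k ≤ K, x k = x' k := by
  intro k
  induction k with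
  | zero => exact fun _ => h0
  | succ k ih =>
    intro hk
    rw [(h k hk).1, (h' k hk).1, ih (by omega), hu k hk]

theorem IsTrajectory.output_eq (h : S.IsTrajectory K u x y) (h' : S.IsTrajectory K u' x' y')
    (hu : ∀ k < K, u k = u' k) (h0 : x 0 = x' 0) : ∀ k < K, y k = y' k := by
  intro k hk
  rw [(h k hk).2, (h' k hk).2, hu k hk, h.state_eq h' hu h0 k hk.le]

variable (S) in
theorem exists_isTrajectory (x₀ : Fin n → ℝ) (u : ℕ → Fin m → ℝ) :
    ∃ (x : ℕ → Fin n → ℝ) (y : ℕ → Fin p → ℝ), x 0 = x₀ ∧ ∀ K, S.IsTrajectory K u x y := by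
  let x : ℕ → Fin n → ℝ := Nat.rec x₀ fun k v => S.A.mulVec v + S.B.mulVec (u k)
  exact ⟨x, fun k => S.C.mulVec (x k) + S.D.mulVec (u k), rfl, fun K k _ => ⟨rfl, rfl⟩⟩

theorem Observable.eq_zero (ho : S.Observable) {v : Fin n → ℝ}
    (hv : ∀ k < n, (S.C * S.A ^ k).mulVec v = 0) : v = 0 := by
  refine Matrix.eq_zero_of_mulVec_eq_zero_of_rank (ho.trans (Fintype.card_fin n).symm) ?_
  ext ⟨k, i⟩
  exact congrFun (hv k k.2) i

theorem Controllable.eq_zero (hc : S.Controllable) {v : Fin n → ℝ}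
    (hv : ∀ k < n, Matrix.vecMul v (S.A ^ k * S.B) = 0) : v = 0 := by
  refine Matrix.rank_eq_card_iff_vecMul_eq_zero.1 (hc.trans (Fintype.card_fin n).symm) v ?_
  ext ⟨k, i⟩
  exact congrFun (hv k k.2) i

theorem Observable.initial_state_eq (ho : S.Observable) (h : S.IsTrajectory n u x y)
    (h' : S.IsTrajectory n u' x' y') (hu : ∀ k < n, u k = u' k) (hy : ∀ k < n, y k = y' k) :
    x 0 = x' 0 := by
  have hA : ∀ k ≤ n, x k - x' k = (S.A ^ k).mulVec (x 0 - x' 0) := by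
    intro k
    induction k with
    | zero => simp
    | succ k ih =>
      intro hk
      rw [pow_succ', ← Matrix.mulVec_mulVec, ← ih (by omega), (h k hk).1, (h' k hk).1, hu k hk,
        Matrix.mulVec_sub]
      abel
  refine sub_eq_zero.1 (ho.eq_zero fun k hk => ?_)
  have h1 := hy k hk
  rw [(h k hk).2, (h' k hk).2, hu k hk, add_left_inj] at h1
  rw [← Matrix.mulVec_mulVec, ← hA k hk.le, Matrix.mulVec_sub, h1, sub_self]

theorem Observable.state_eq (ho : S.Observable) (h : S.IsTrajectory n u x y)
    (h' : S.IsTrajectory n u' x' y') (hu : ∀ k < n, u k = u' k) (hy : ∀ k < n, y k = y' k) :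
    ∀ k ≤ n, x k = x' k :=
  h.state_eq h' hu (ho.initial_state_eq h h' hu hy)

end LTISystem

section FundamentalLemma

variable {n m p : ℕ} {S : LTISystem n m p}

theorem PersistentlyExciting.eq_zero {q N K : ℕ} {w : ℕ → Fin q → ℝ}
    (h : PersistentlyExciting N K w) {Z : ℕ → Fin q → ℝ}
    (hZ : ∀ j < N + 1 - K, ∑ t ∈ Finset.range K, Z t ⬝ᵥ w (t + j) = 0) : ∀ t < K, Z t = 0 := by
  have hcard : (hankel N K w).rank = Fintype.card (Fin K × Fin q) := by
    rw [h, Fintype.card_prod, Fintype.card_fin, Fintype.card_fin, mul_comm]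
  have h0 := Matrix.rank_eq_card_iff_vecMul_eq_zero.1 hcard (fun r => Z r.1 r.2) ?_
  · intro t ht
    ext i
    exact congrFun h0 (⟨t, ht⟩, i)
  · ext j
    rw [Pi.zero_apply, ← hZ j j.2, ← Fin.sum_univ_eq_sum_range (fun t => Z t ⬝ᵥ w (t + j))]
    simp [Matrix.vecMul, dotProduct, hankel, Fintype.sum_prod_type]

variable {N K K₀ : ℕ} {ud : ℕ → Fin m → ℝ} {xd : ℕ → Fin n → ℝ} {yd : ℕ → Fin p → ℝ}

/-- The coefficients of a left kernel vector `(η, ξ)` of the matrix with the columns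
`(u_j, …, u_{j+K-1}, x_j)`, preceded by `ξ Aⁿ⁻¹ B, …, ξ A B, ξ B`. Eliminating `x_{j+s}` through
`x_j` turns the kernel relation at `j + s` into one with these coefficients, moved by `n - s`. -/
def kernelCoeff (S : LTISystem n m p) (η : ℕ → Fin m → ℝ) (ξ : Fin n → ℝ) (i : ℕ) : Fin m → ℝ :=
  if i < n then Matrix.vecMul ξ (S.A ^ (n - 1 - i) * S.B) else η (i - n)

theorem kernel_relation_shift (hd : S.IsTrajectory K₀ ud xd yd) (hN : N ≤ K₀)
    {η : ℕ → Fin m → ℝ} {ξ : Fin n → ℝ} (hη : ∀ t, K ≤ t → η t = 0)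
    (hker : ∀ j < N + 1 - K, ∑ t ∈ Finset.range K, η t ⬝ᵥ ud (t + j) + ξ ⬝ᵥ xd j = 0)
    {s : ℕ} (hs : s ≤ n) : ∀ j, j + s < N + 1 - K →
      ∑ t ∈ Finset.range (K + n), kernelCoeff S η ξ (t + n - s) ⬝ᵥ ud (t + j) +
        Matrix.vecMul ξ (S.A ^ s) ⬝ᵥ xd j = 0 := by
  induction s with
  | zero =>
    intro j hj
    rw [← hker j hj, Finset.sum_range_add]
    simp [kernelCoeff, hη]
  | succ s ih =>
    intro j hj
    have h := ih (by omega) (j + 1) (by omega)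
    have hj' : j < K₀ := by omega
    rw [(hd j hj').1] at h
    have h0 : kernelCoeff S η ξ (0 + n - (s + 1)) = Matrix.vecMul ξ (S.A ^ s * S.B) := by
      have h1 : n - 1 - (0 + n - (s + 1)) = s := by omega
      rw [kernelCoeff, if_pos (by omega), h1]
    have hlast : kernelCoeff S η ξ (K + n + n - (s + 1)) = 0 := by
      rw [kernelCoeff, if_neg (by omega), hη _ (by omega)]
    have hsum : ∑ t ∈ Finset.range (K + n), kernelCoeff S η ξ (t + n - (s + 1)) ⬝ᵥ ud (t + j) =
        ∑ t ∈ Finset.range (K + n), kernelCoeff S η ξ (t + n - s) ⬝ᵥ ud (t + (j + 1)) +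
          Matrix.vecMul ξ (S.A ^ s * S.B) ⬝ᵥ ud j := by
      have h1 := Finset.sum_range_succ
        (fun t => kernelCoeff S η ξ (t + n - (s + 1)) ⬝ᵥ ud (t + j)) (K + n)
      rw [hlast, zero_dotProduct, add_zero, Finset.sum_range_succ', h0, zero_add] at h1
      rw [← h1]
      congr 1
      refine Finset.sum_congr rfl fun t _ => ?_
      have h2 : t + 1 + n - (s + 1) = t + n - s := by omega
      rw [h2, add_assoc, add_comm 1 j]
    rw [hsum, ← h, dotProduct_add, pow_succ, ← Matrix.vecMul_vecMul, ← Matrix.vecMul_vecMul,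
      Matrix.dotProduct_mulVec _ S.A, Matrix.dotProduct_mulVec _ S.B]
    abel

/-- By the Cayley–Hamilton theorem the states drop out of a suitable combination of the shifted
kernel relations, and persistency of excitation applies to what remains. -/
theorem charpoly_conv_kernelCoeff_eq_zero (hd : S.IsTrajectory K₀ ud xd yd) (hN : N ≤ K₀)
    (hpe : PersistentlyExciting N (K + n) ud)
    {η : ℕ → Fin m → ℝ} {ξ : Fin n → ℝ} (hη : ∀ t, K ≤ t → η t = 0)
    (hker : ∀ j < N + 1 - K, ∑ t ∈ Finset.range K, η t ⬝ᵥ ud (t + j) + ξ ⬝ᵥ xd j = 0) :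
    ∀ t < K + n, ∑ s ∈ Finset.range (n + 1),
      S.A.charpoly.coeff s • kernelCoeff S η ξ (t + n - s) = 0 := by
  refine hpe.eq_zero fun j hj => ?_
  have hCH : ∑ s ∈ Finset.range (n + 1), S.A.charpoly.coeff s • S.A ^ s = 0 := by
    have h := S.A.aeval_self_charpoly
    rwa [Polynomial.aeval_eq_sum_range, Matrix.charpoly_natDegree_eq_dim, Fintype.card_fin] at h
  have hx : ∑ s ∈ Finset.range (n + 1),
      S.A.charpoly.coeff s * (Matrix.vecMul ξ (S.A ^ s) ⬝ᵥ xd j) = 0 := by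
    have h := congrArg (fun M => Matrix.vecMul ξ M ⬝ᵥ xd j) hCH
    simpa [Matrix.vecMul_sum, Matrix.vecMul_smul, sum_dotProduct, smul_dotProduct] using h
  have hsum : ∑ s ∈ Finset.range (n + 1), S.A.charpoly.coeff s *
      (∑ t ∈ Finset.range (K + n), kernelCoeff S η ξ (t + n - s) ⬝ᵥ ud (t + j) +
        Matrix.vecMul ξ (S.A ^ s) ⬝ᵥ xd j) = 0 := by
    refine Finset.sum_eq_zero fun s hs => ?_
    have hs' : s ≤ n := Nat.lt_succ_iff.1 (Finset.mem_range.1 hs)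
    rw [kernel_relation_shift hd hN hη hker hs' j (by omega), mul_zero]
  simp only [mul_add, Finset.sum_add_distrib, hx, add_zero, Finset.mul_sum] at hsum
  rw [Finset.sum_comm] at hsum
  simpa only [sum_dotProduct, smul_dotProduct, smul_eq_mul] using hsum

theorem left_kernel_eq_zero (hc : S.Controllable) (hd : S.IsTrajectory K₀ ud xd yd) (hN : N ≤ K₀)
    (hpe : PersistentlyExciting N (K + n) ud)
    {η : ℕ → Fin m → ℝ} {ξ : Fin n → ℝ} (hη : ∀ t, K ≤ t → η t = 0)
    (hker : ∀ j < N + 1 - K, ∑ t ∈ Finset.range K, η t ⬝ᵥ ud (t + j) + ξ ⬝ᵥ xd j = 0) :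
    (∀ t, η t = 0) ∧ ξ = 0 := by
  have hconv := charpoly_conv_kernelCoeff_eq_zero hd hN hpe hη hker
  have hlead : S.A.charpoly.coeff n = 1 := by
    simpa [Polynomial.Monic, Polynomial.leadingCoeff, Matrix.charpoly_natDegree_eq_dim] using
      S.A.charpoly_monic
  -- The characteristic polynomial is monic, so that the relation at `t` expresses the
  -- coefficient at `t` through the later ones, which vanish from `K + n` on.
  have hzero : ∀ d i, K + n ≤ i + d → kernelCoeff S η ξ i = 0 := by
    intro d
    induction d with
    | zero =>
      intro i hi
      rw [kernelCoeff, if_neg (by omega), hη _ (by omega)]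
    | succ d ih =>
      intro i hi
      rcases le_or_gt (K + n) i with h | h
      · exact ih i (by omega)
      have h1 := hconv i h
      rw [Finset.sum_range_succ, hlead, one_smul, Nat.add_sub_cancel, Finset.sum_eq_zero,
        zero_add] at h1
      · exact h1
      · intro s hs
        have hs' := Finset.mem_range.1 hs
        rw [ih _ (by omega), smul_zero]
  have hall : ∀ i, kernelCoeff S η ξ i = 0 := fun i => hzero (K + n) i (by omega)
  constructor
  · intro t
    have h := hall (t + n)
    rwa [kernelCoeff, if_neg (by omega), Nat.add_sub_cancel] at h
  · refine hc.eq_zero fun k hk => ?_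
    have h := hall (n - 1 - k)
    have h1 : n - 1 - (n - 1 - k) = k := by omega
    rwa [kernelCoeff, if_pos (by omega), h1] at h

/-- The form of Willems' fundamental lemma used here: every initial state and every input sequence
of length `K` is a combination of those found in the data. -/
theorem exists_delayComb_eq (hc : S.Controllable) (hd : S.IsTrajectory K₀ ud xd yd) (hN : N ≤ K₀)
    (hpe : PersistentlyExciting N (K + n) ud) (w : ℕ → Fin m → ℝ) (x₀ : Fin n → ℝ) :
    ∃ a : Fin (N + 1 - K) → ℝ, (∀ i < K, delayComb a ud i = w i) ∧ delayComb a xd 0 = x₀ := by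
  let M : Matrix ((Fin K × Fin m) ⊕ Fin n) (Fin (N + 1 - K)) ℝ :=
    Matrix.fromRows (hankel N K ud) (Matrix.of fun i j => xd j i)
  have hM : Function.Surjective M.mulVec := by
    refine Matrix.mulVec_surjective_of_vecMul_eq_zero fun v hv => ?_
    let η : ℕ → Fin m → ℝ := fun t => if h : t < K then fun i => v (Sum.inl (⟨t, h⟩, i)) else 0
    obtain ⟨h1, h2⟩ := left_kernel_eq_zero (η := η) (ξ := fun i => v (Sum.inr i)) hc hd hN hpe
      (fun t ht => dif_neg (by omega)) (fun j hj => by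
        have h := congrFun hv ⟨j, hj⟩
        rw [← Fin.sum_univ_eq_sum_range (fun t => η t ⬝ᵥ ud (t + j))]
        simpa [M, η, Matrix.vecMul, dotProduct, hankel, Fintype.sum_prod_type,
          Fintype.sum_sum_type] using h)
    ext (⟨t, i⟩ | i)
    · simpa [η] using congrFun (h1 t) i
    · exact congrFun h2 i
  obtain ⟨a, ha⟩ := hM (Sum.elim (fun r => w r.1 r.2) x₀)
  rw [Matrix.fromRows_mulVec] at ha
  refine ⟨a, fun i hi => ?_, ?_⟩
  · ext l
    have h := congrFun ha (Sum.inl (⟨i, hi⟩, l))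
    simpa [hankel_mulVec] using h
  · ext l
    have h := congrFun ha (Sum.inr l)
    simpa [Matrix.mulVec, dotProduct, delayComb, mul_comm] using h

/-- Every trajectory of length `K` is a combination of those found in the data. -/
theorem exists_delayComb_eq_trajectory (hc : S.Controllable) (hd : S.IsTrajectory K₀ ud xd yd)
    (hN : N ≤ K₀) (hpe : PersistentlyExciting N (K + n) ud)
    {u : ℕ → Fin m → ℝ} {x : ℕ → Fin n → ℝ} {y : ℕ → Fin p → ℝ} {K' : ℕ} (hK' : K' ≤ K)
    (h : S.IsTrajectory K' u x y) :
    ∃ a : Fin (N + 1 - K) → ℝ, (∀ i < K', delayComb a ud i = u i) ∧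
      (∀ i ≤ K', delayComb a xd i = x i) ∧ ∀ i < K', delayComb a yd i = y i := by
  obtain ⟨a, hu, hx⟩ := exists_delayComb_eq hc hd hN hpe u (x 0)
  have hu' : ∀ i < K', delayComb a ud i = u i := fun i hi => hu i (hi.trans_le hK')
  have ha := (hd.delayComb a (K' := K) fun _ => by omega).mono hK'
  exact ⟨a, hu', ha.state_eq h hu' hx, ha.output_eq h hu' hx⟩

end FundamentalLemma

/-! ### Convexity and positivity of the two problems -/

section WeightedSquares

variable {ι E : Type*} [Fintype ι] [AddCommGroup E] [Module ℝ E]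

theorem wsq_nonneg {W : Matrix ι ι ℝ} (hW : W.PosSemidef) (v : ι → ℝ) : 0 ≤ wsq W v := by
  simpa [wsq] using hW.dotProduct_mulVec_nonneg v

theorem eq_zero_of_wsq_nonpos {W : Matrix ι ι ℝ} (hW : W.PosDef) {v : ι → ℝ} (h : wsq W v ≤ 0) :
    v = 0 := by
  by_contra hv
  have : 0 < wsq W v := by simpa [wsq] using hW.dotProduct_mulVec_pos hv
  linarith

theorem wsq_transpose_mul_mul {κ : Type*} [Fintype κ] (T : Matrix κ ι ℝ) (W : Matrix κ κ ℝ)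
    (v : ι → ℝ) : wsq (T.transpose * W * T) v = wsq W (T.mulVec v) := by
  rw [wsq, wsq, ← Matrix.mulVec_mulVec, ← Matrix.mulVec_mulVec, Matrix.dotProduct_mulVec,
    Matrix.vecMul_transpose]

theorem wsq_fromBlocks_diagonal {κ : Type*} [Fintype κ] (R : Matrix ι ι ℝ) (Q : Matrix κ κ ℝ)
    (v : ι ⊕ κ → ℝ) :
    wsq (Matrix.fromBlocks R 0 0 Q) v =
      wsq R (fun i => v (Sum.inl i)) + wsq Q (fun i => v (Sum.inr i)) := by
  simp [wsq, Matrix.fromBlocks_mulVec, dotProduct, Fintype.sum_sum_type, Function.comp_def]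

theorem wsq_add_left (W W' : Matrix ι ι ℝ) (v : ι → ℝ) :
    wsq (W + W') v = wsq W v + wsq W' v := by
  simp [wsq, Matrix.add_mulVec]

theorem wsq_zero_left (v : ι → ℝ) : wsq (0 : Matrix ι ι ℝ) v = 0 := by
  simp [wsq]

/-- `wsq W` composed with a linear map, as a quadratic form. -/
noncomputable def wsqForm (W : Matrix ι ι ℝ) (f : E →ₗ[ℝ] ι → ℝ) : QuadraticForm ℝ E :=
  open Classical in (LinearMap.BilinMap.toQuadraticMap (Matrix.toLinearMap₂' ℝ W)).comp f

theorem wsqForm_apply (W : Matrix ι ι ℝ) (f : E →ₗ[ℝ] ι → ℝ) (v : E) :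
    wsqForm W f v = wsq W (f v) := by
  classical
  simp [wsqForm, wsq, Matrix.toLinearMap₂'_apply']

theorem continuous_wsqForm {E : Type*} [NormedAddCommGroup E] [NormedSpace ℝ E]
    [FiniteDimensional ℝ E] (W : Matrix ι ι ℝ) (f : E →ₗ[ℝ] ι → ℝ) : Continuous (wsqForm W f) := by
  have hf : Continuous f := f.continuous_of_finiteDimensional
  have h : ⇑(wsqForm W f) = fun v => f v ⬝ᵥ W.mulVec (f v) := funext fun v => wsqForm_apply W f v
  rw [h]
  exact hf.dotProduct (continuous_const.matrix_mulVec hf)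

end WeightedSquares

section StackSets

variable {n m p : ℕ} {U : Set (Fin m → ℝ)} {Y : Set (Fin p → ℝ)}

theorem isClosed_stackSet (hU : IsClosed U) (hY : IsClosed Y) : IsClosed (stackSet n U Y) := by
  refine IsClosed.inter (s₁ := {z : IOIndex n m p → ℝ | _}) (s₂ := {z : IOIndex n m p → ℝ | _})
    ?_ ?_
  · simp only [Set.ofPred_forall]
    exact isClosed_iInter fun i => hU.preimage (by fun_prop)
  · simp only [Set.ofPred_forall]
    exact isClosed_iInter fun i => hY.preimage (by fun_prop)

theorem convex_stackSet (hU : Convex ℝ U) (hY : Convex ℝ Y) : Convex ℝ (stackSet n U Y) :=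
  fun _ hx _ hy _ _ ha hb hab => ⟨fun i => hU (hx.1 i) (hy.1 i) ha hb hab,
    fun i => hY (hx.2 i) (hy.2 i) ha hb hab⟩

end StackSets

section RelaxedProblem

variable {n m p L N : ℕ} {ud : ℕ → Fin m → ℝ} {yd : ℕ → Fin p → ℝ} {χ₀ : IOIndex n m p → ℝ}
  {U : Set (Fin m → ℝ)} {Y : Set (Fin p → ℝ)}

/-- The points that satisfy the Hankel constraints of the relaxed problem; as these are homogeneous,
the differences of feasible points belong to it. -/
def hankelSubmodule (L N : ℕ) (ud : ℕ → Fin m → ℝ) (yd : ℕ → Fin p → ℝ) :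
    Submodule ℝ (RelaxedVar n m p L N) where
  carrier := {d | (∀ j i, d.2.1 j i = (hankel N (n + L) ud).mulVec d.1 (j, i)) ∧
    ∀ j i, d.2.2 j i = (hankel N (n + L) yd).mulVec d.1 (j, i)}
  zero_mem' := by simp
  add_mem' := by
    rintro a b ⟨h1, h2⟩ ⟨h3, h4⟩
    constructor <;> intro j i <;> simp [Matrix.mulVec_add, h1, h2, h3, h4]
  smul_mem' := by
    rintro c a ⟨h1, h2⟩
    constructor <;> intro j i <;> simp [Matrix.mulVec_smul, h1, h2]

theorem sub_mem_hankelSubmodule {a b : RelaxedVar n m p L N}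
    (ha : a ∈ relaxedFeasible N ud yd χ₀ U Y) (hb : b ∈ relaxedFeasible N ud yd χ₀ U Y) :
    a - b ∈ hankelSubmodule L N ud yd :=
  (hankelSubmodule L N ud yd).sub_mem ⟨ha.1, ha.2.1⟩ ⟨hb.1, hb.2.1⟩

theorem eq_zero_of_mem_hankelSubmodule {d : RelaxedVar n m p L N}
    (hd : d ∈ hankelSubmodule L N ud yd) (h : d.1 = 0) : d = 0 := by
  obtain ⟨a, u, y⟩ := d
  obtain rfl : a = 0 := h
  obtain ⟨h1, h2⟩ := hd
  have hu : u = 0 := by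
    ext j i
    simpa using h1 j i
  have hy : y = 0 := by
    ext j i
    simpa using h2 j i
  rw [hu, hy]
  rfl

theorem isClosed_relaxedFeasible (hU : IsClosed U) (hY : IsClosed Y) :
    IsClosed (relaxedFeasible (L := L) N ud yd χ₀ U Y) := by
  have hs : Continuous fun d : RelaxedVar n m p L N =>
      (stack (window d.2.1 0) (window d.2.2 0) : IOIndex n m p → ℝ) := by
    refine continuous_pi ?_
    rintro (⟨i, l⟩ | ⟨i, l⟩) <;> simp only [stack, window, Sum.elim_inl, Sum.elim_inr] <;> fun_prop
  have h1 : IsClosed {d : RelaxedVar n m p L N | ∀ j i, d.2.1 j i =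
      (hankel N (n + L) ud).mulVec d.1 (j, i)} := by
    simp only [Set.ofPred_forall]
    refine isClosed_iInter fun j => isClosed_iInter fun i => isClosed_eq (by fun_prop) ?_
    exact (continuous_apply _).comp (continuous_const.matrix_mulVec continuous_fst)
  have h2 : IsClosed {d : RelaxedVar n m p L N | ∀ j i, d.2.2 j i =
      (hankel N (n + L) yd).mulVec d.1 (j, i)} := by
    simp only [Set.ofPred_forall]
    refine isClosed_iInter fun j => isClosed_iInter fun i => isClosed_eq (by fun_prop) ?_
    exact (continuous_apply _).comp (continuous_const.matrix_mulVec continuous_fst)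
  have h4 : IsClosed {d : RelaxedVar n m p L N | ∀ k : Fin L,
      future d.2.1 k ∈ U ∧ future d.2.2 k ∈ Y} := by
    simp only [Set.ofPred_forall, future]
    exact isClosed_iInter fun k => (hU.preimage (by fun_prop)).inter (hY.preimage (by fun_prop))
  exact h1.inter (h2.inter ((isClosed_eq hs continuous_const).inter h4))

theorem convex_relaxedFeasible (hU : Convex ℝ U) (hY : Convex ℝ Y) :
    Convex ℝ (relaxedFeasible (L := L) N ud yd χ₀ U Y) := by
  rintro d ⟨h1, h2, h3, h4⟩ d' ⟨h1', h2', h3', h4'⟩ a b ha hb hab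
  refine ⟨fun j i => ?_, fun j i => ?_, ?_, fun k =>
    ⟨hU (h4 k).1 (h4' k).1 ha hb hab, hY (h4 k).2 (h4' k).2 ha hb hab⟩⟩
  · simp [Matrix.mulVec_add, Matrix.mulVec_smul, h1, h1']
  · simp [Matrix.mulVec_add, Matrix.mulVec_smul, h2, h2']
  · have hχ : χ₀ = a • χ₀ + b • χ₀ := by rw [← add_smul, hab, one_smul]
    rw [hχ]
    nth_rewrite 1 [← h3]
    rw [← h3']
    ext (i | i) <;> simp [stack, window]

/-- The last `n` inputs and outputs as a linear function of the decision variables. -/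
def lastStack (n m p L N : ℕ) : RelaxedVar n m p L N →ₗ[ℝ] IOIndex n m p → ℝ where
  toFun d := stack (window d.2.1 (Fin.last L)) (window d.2.2 (Fin.last L))
  map_add' d d' := by ext (i | i) <;> simp [stack, window]
  map_smul' c d := by ext (i | i) <;> simp [stack, window]

/-- The cost of the relaxed problem as a quadratic form. -/
noncomputable def relaxedCostForm (L N : ℕ) (Q : Matrix (Fin p) (Fin p) ℝ)
    (R : Matrix (Fin m) (Fin m) ℝ) (P : Matrix (IOIndex n m p) (IOIndex n m p) ℝ) (ρ : ℝ) :
    QuadraticForm ℝ (RelaxedVar n m p L N) :=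
  ∑ k : Fin L, (wsqForm Q (LinearMap.proj (Fin.natAdd n k) ∘ₗ LinearMap.snd ℝ _ _ ∘ₗ
      LinearMap.snd ℝ _ _) +
    wsqForm R (LinearMap.proj (Fin.natAdd n k) ∘ₗ LinearMap.fst ℝ _ _ ∘ₗ LinearMap.snd ℝ _ _)) +
  wsqForm P (lastStack n m p L N) + ρ • wsqForm 1 (LinearMap.fst ℝ _ _)

theorem coe_relaxedCostForm (Q : Matrix (Fin p) (Fin p) ℝ) (R : Matrix (Fin m) (Fin m) ℝ)
    (P : Matrix (IOIndex n m p) (IOIndex n m p) ℝ) (ρ : ℝ) :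
    ⇑(relaxedCostForm L N Q R P ρ) = relaxedCost Q R P ρ := by
  ext d
  simp only [relaxedCostForm, relaxedCost, add_apply, sum_apply,
    smul_apply, wsqForm_apply]
  simp [wsq, lastStack, future]

theorem continuous_relaxedCostForm (Q : Matrix (Fin p) (Fin p) ℝ) (R : Matrix (Fin m) (Fin m) ℝ)
    (P : Matrix (IOIndex n m p) (IOIndex n m p) ℝ) (ρ : ℝ) :
    Continuous (relaxedCostForm L N Q R P ρ) := by
  have h : ⇑(relaxedCostForm L N Q R P ρ) = fun d => ∑ k : Fin L,
      (wsqForm Q (LinearMap.proj (Fin.natAdd n k) ∘ₗ LinearMap.snd ℝ _ _ ∘ₗ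
        LinearMap.snd ℝ _ _) d + wsqForm R (LinearMap.proj (Fin.natAdd n k) ∘ₗ
          LinearMap.fst ℝ _ _ ∘ₗ LinearMap.snd ℝ _ _) d) +
      wsqForm P (lastStack n m p L N) d + ρ • wsqForm 1 (LinearMap.fst ℝ _ _) d := by
    ext d
    simp [relaxedCostForm]
  rw [h]
  refine ((continuous_finsetSum _ fun k _ => ?_).add (continuous_wsqForm _ _)).add
    ((continuous_wsqForm _ _).const_smul ρ)
  exact (continuous_wsqForm _ _).add (continuous_wsqForm _ _)

theorem mul_dotProduct_le_relaxedCost {Q : Matrix (Fin p) (Fin p) ℝ}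
    {R : Matrix (Fin m) (Fin m) ℝ} {P : Matrix (IOIndex n m p) (IOIndex n m p) ℝ}
    (hQ : Q.PosSemidef) (hR : R.PosSemidef) (hP : P.PosSemidef) (ρ : ℝ)
    (d : RelaxedVar n m p L N) : ρ * (d.1 ⬝ᵥ d.1) ≤ relaxedCost Q R P ρ d := by
  have h1 : 0 ≤ ∑ k : Fin L, (wsq Q (future d.2.2 k) + wsq R (future d.2.1 k)) :=
    Finset.sum_nonneg fun k _ => add_nonneg (wsq_nonneg hQ _) (wsq_nonneg hR _)
  have h2 := wsq_nonneg hP (stack (window d.2.1 (Fin.last L)) (window d.2.2 (Fin.last L)))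
  rw [relaxedCost]
  linarith

end RelaxedProblem

section StateProblem

variable {m L N₁ s : ℕ} {σ : Type} [Fintype σ] {X₁ : Matrix σ (Fin N₁) ℝ}
  {G : Matrix (Fin N₁) (Fin m ⊕ σ) ℝ} {ξ₀ : σ → ℝ} {U : Set (Fin m → ℝ)} {X : Set (σ → ℝ)}

/-- The points that follow the prediction model from the initial state `0`; they contain the
differences of feasible points. -/
def predictionSubmodule (L : ℕ) (A : Matrix σ (Fin m ⊕ σ) ℝ) :
    Submodule ℝ (EDDPCVar m L σ) where
  carrier := {e | (∀ k : Fin L, e.2 k.succ = A.mulVec (Sum.elim (e.1 k) (e.2 k.castSucc))) ∧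
    e.2 0 = 0}
  zero_mem' := by
    refine ⟨fun k => ?_, rfl⟩
    have h : (Sum.elim 0 0 : Fin m ⊕ σ → ℝ) = 0 := by ext (i | i) <;> rfl
    simp [h]
  add_mem' := by
    rintro a b ⟨h1, h2⟩ ⟨h3, h4⟩
    refine ⟨fun k => ?_, by simp [h2, h4]⟩
    have h : (Sum.elim (a.1 k + b.1 k) (a.2 k.castSucc + b.2 k.castSucc) : Fin m ⊕ σ → ℝ) =
        Sum.elim (a.1 k) (a.2 k.castSucc) + Sum.elim (b.1 k) (b.2 k.castSucc) := by
      ext (i | i) <;> rfl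
    simp [h, Matrix.mulVec_add, h1, h3]
  smul_mem' := by
    rintro c a ⟨h1, h2⟩
    refine ⟨fun k => ?_, by simp [h2]⟩
    have h : (Sum.elim (c • a.1 k) (c • a.2 k.castSucc) : Fin m ⊕ σ → ℝ) =
        c • Sum.elim (a.1 k) (a.2 k.castSucc) := by
      ext (i | i) <;> rfl
    simp [h, Matrix.mulVec_smul, h1]

theorem sub_mem_predictionSubmodule {a b : EDDPCVar m L σ}
    (ha : a ∈ eddpcFeasible X₁ G ξ₀ U X s) (hb : b ∈ eddpcFeasible X₁ G ξ₀ U X s) :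
    a - b ∈ predictionSubmodule L (X₁ * G) := by
  refine ⟨fun k => ?_, by simp [ha.2.1, hb.2.1]⟩
  have h : (Sum.elim (a.1 k - b.1 k) (a.2 k.castSucc - b.2 k.castSucc) : Fin m ⊕ σ → ℝ) =
      Sum.elim (a.1 k) (a.2 k.castSucc) - Sum.elim (b.1 k) (b.2 k.castSucc) := by
    ext (i | i) <;> rfl
  simp only [Prod.fst_sub, Prod.snd_sub, Pi.sub_apply]
  rw [h, Matrix.mulVec_sub, ha.1, hb.1]

theorem eq_zero_of_mem_predictionSubmodule {A : Matrix σ (Fin m ⊕ σ) ℝ} {e : EDDPCVar m L σ}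
    (he : e ∈ predictionSubmodule L A) (h : ∀ k, e.1 k = 0) : e = 0 := by
  have h2 : ∀ k, e.2 k = 0 := by
    intro k
    induction k using Fin.induction with
    | zero => exact he.2
    | succ k ih =>
      have h0 : (Sum.elim 0 0 : Fin m ⊕ σ → ℝ) = 0 := by ext (i | i) <;> rfl
      rw [he.1 k, ih, h k, h0, Matrix.mulVec_zero]
  exact Prod.ext (funext h) (funext h2)

theorem isClosed_eddpcFeasible (hU : IsClosed U) (hX : IsClosed X) :
    IsClosed (eddpcFeasible (L := L) X₁ G ξ₀ U X s) := by
  have h1 : IsClosed {e : EDDPCVar m L σ | ∀ k : Fin L,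
      e.2 k.succ = (X₁ * G).mulVec (Sum.elim (e.1 k) (e.2 k.castSucc))} := by
    simp only [Set.ofPred_forall]
    refine isClosed_iInter fun k => isClosed_eq (by fun_prop) ?_
    refine continuous_const.matrix_mulVec (continuous_pi ?_)
    rintro (i | i) <;> simp only [Sum.elim_inl, Sum.elim_inr] <;> fun_prop
  have h2 : IsClosed {e : EDDPCVar m L σ | e.2 0 = ξ₀} :=
    isClosed_eq (by fun_prop) continuous_const
  have h3 : IsClosed {e : EDDPCVar m L σ | ∀ k : Fin L, e.1 k ∈ U} := by
    simp only [Set.ofPred_forall]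
    exact isClosed_iInter fun k => hU.preimage (by fun_prop)
  have h4 : IsClosed {e : EDDPCVar m L σ | ∀ k : Fin (L + 1), (k : ℕ) < s → e.2 k ∈ X} := by
    simp only [Set.ofPred_forall]
    exact isClosed_iInter fun k => isClosed_iInter fun _ => hX.preimage (by fun_prop)
  exact h1.inter (h2.inter (h3.inter h4))

theorem convex_eddpcFeasible (hU : Convex ℝ U) (hX : Convex ℝ X) :
    Convex ℝ (eddpcFeasible (L := L) X₁ G ξ₀ U X s) := by
  rintro d ⟨h1, h2, h3, h4⟩ d' ⟨h1', h2', h3', h4'⟩ a b ha hb hab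
  refine ⟨fun k => ?_, ?_, fun k => hU (h3 k) (h3' k) ha hb hab,
    fun k hk => hX (h4 k hk) (h4' k hk) ha hb hab⟩
  · have h : (Sum.elim (a • d.1 k + b • d'.1 k) (a • d.2 k.castSucc + b • d'.2 k.castSucc) :
        Fin m ⊕ σ → ℝ) =
        a • Sum.elim (d.1 k) (d.2 k.castSucc) + b • Sum.elim (d'.1 k) (d'.2 k.castSucc) := by
      ext (i | i) <;> rfl
    simp only [Prod.fst_add, Prod.snd_add, Prod.smul_fst, Prod.smul_snd, Pi.add_apply,
      Pi.smul_apply]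
    rw [h, Matrix.mulVec_add, Matrix.mulVec_smul, Matrix.mulVec_smul, h1, h1']
  · simp [h2, h2', ← add_smul, hab]

/-- The cost of E-DDPC as a quadratic form. -/
noncomputable def eddpcCostForm (L : ℕ) (Q : Matrix σ σ ℝ) (R : Matrix (Fin m) (Fin m) ℝ)
    (P : Matrix σ σ ℝ) : QuadraticForm ℝ (EDDPCVar m L σ) :=
  ∑ k : Fin L, (wsqForm Q (LinearMap.proj k.castSucc ∘ₗ LinearMap.snd ℝ _ _) +
    wsqForm R (LinearMap.proj k ∘ₗ LinearMap.fst ℝ _ _)) +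
  wsqForm P (LinearMap.proj (Fin.last L) ∘ₗ LinearMap.snd ℝ _ _)

theorem coe_eddpcCostForm (Q : Matrix σ σ ℝ) (R : Matrix (Fin m) (Fin m) ℝ) (P : Matrix σ σ ℝ) :
    ⇑(eddpcCostForm L Q R P) = eddpcCost Q R P := by
  ext e
  simp [eddpcCostForm, eddpcCost, wsqForm_apply]

theorem continuous_eddpcCostForm (Q : Matrix σ σ ℝ) (R : Matrix (Fin m) (Fin m) ℝ)
    (P : Matrix σ σ ℝ) : Continuous (eddpcCostForm L Q R P) := by
  have h : ⇑(eddpcCostForm L Q R P) = fun e =>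
      ∑ k : Fin L, (wsqForm Q (LinearMap.proj k.castSucc ∘ₗ LinearMap.snd ℝ _ _) e +
        wsqForm R (LinearMap.proj k ∘ₗ LinearMap.fst ℝ _ _) e) +
      wsqForm P (LinearMap.proj (Fin.last L) ∘ₗ LinearMap.snd ℝ _ _) e := by
    ext e
    simp [eddpcCostForm]
  rw [h]
  exact (continuous_finsetSum _ fun k _ =>
    (continuous_wsqForm _ _).add (continuous_wsqForm _ _)).add (continuous_wsqForm _ _)

theorem eddpcCost_nonneg {Q : Matrix σ σ ℝ} {R : Matrix (Fin m) (Fin m) ℝ} {P : Matrix σ σ ℝ}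
    (hQ : Q.PosSemidef) (hR : R.PosSemidef) (hP : P.PosSemidef) (e : EDDPCVar m L σ) :
    0 ≤ eddpcCost Q R P e :=
  add_nonneg (Finset.sum_nonneg fun _ _ => add_nonneg (wsq_nonneg hQ _) (wsq_nonneg hR _))
    (wsq_nonneg hP _)

/-- All terms of a nonnegative cost vanish together with it. -/
theorem wsq_nonpos_of_eddpcCost_nonpos {Q : Matrix σ σ ℝ} {R : Matrix (Fin m) (Fin m) ℝ}
    {P : Matrix σ σ ℝ} (hQ : Q.PosSemidef) (hR : R.PosSemidef) (hP : P.PosSemidef)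
    {e : EDDPCVar m L σ} (he : eddpcCost Q R P e ≤ 0) :
    (∀ k : Fin L, wsq Q (e.2 k.castSucc) ≤ 0 ∧ wsq R (e.1 k) ≤ 0) ∧
      wsq P (e.2 (Fin.last L)) ≤ 0 := by
  have h1 : ∀ k : Fin L, 0 ≤ wsq Q (e.2 k.castSucc) + wsq R (e.1 k) := fun k =>
    add_nonneg (wsq_nonneg hQ _) (wsq_nonneg hR _)
  have h2 := wsq_nonneg hP (e.2 (Fin.last L))
  have h3 := Finset.sum_nonneg fun k (_ : k ∈ Finset.univ) => h1 k
  rw [eddpcCost] at he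
  refine ⟨fun k => ?_, by linarith⟩
  have h4 := Finset.single_le_sum (fun k _ => h1 k) (Finset.mem_univ k)
  have h5 := wsq_nonneg hQ (e.2 k.castSucc)
  have h6 := wsq_nonneg hR (e.1 k)
  constructor <;> linarith

end StateProblem

/-- Convergence of the minimizers for the two problems of predictive control: what remains to be
checked is that the cost of E-DDPC is positive on nonzero homogeneous predictions. -/
theorem minimizersConverge_eddpc {n m p L N N₁ s : ℕ} {σ : Type} [Fintype σ]
    {ud : ℕ → Fin m → ℝ} {yd : ℕ → Fin p → ℝ} {χ₀ : IOIndex n m p → ℝ}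
    {X₁ : Matrix σ (Fin N₁) ℝ} {G : Matrix (Fin N₁) (Fin m ⊕ σ) ℝ} {ξ₀ : σ → ℝ}
    {U : Set (Fin m → ℝ)} {Y : Set (Fin p → ℝ)} {X : Set (σ → ℝ)}
    (hU : IsClosed U) (hU' : Convex ℝ U) (hY : IsClosed Y) (hY' : Convex ℝ Y)
    (hX : IsClosed X) (hX' : Convex ℝ X)
    {Q : Matrix (Fin p) (Fin p) ℝ} {R : Matrix (Fin m) (Fin m) ℝ}
    {P : Matrix (IOIndex n m p) (IOIndex n m p) ℝ}
    (hQ : Q.PosSemidef) (hR : R.PosSemidef) (hP : P.PosSemidef)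
    {Qt Pt : Matrix σ σ ℝ} {Rt : Matrix (Fin m) (Fin m) ℝ}
    (hQt : Qt.PosSemidef) (hRt : Rt.PosSemidef) (hPt : Pt.PosSemidef)
    {Φ : RelaxedVar n m p L N → EDDPCVar m L σ} {c : ℝ}
    (h : VanishingEquivalent (relaxedFeasible N ud yd χ₀ U Y) (relaxedCost Q R P)
      (fun d => d.1 ⬝ᵥ d.1) (eddpcFeasible X₁ G ξ₀ U X s) (eddpcCost Qt Rt Pt) Φ c)
    (hpos : ∀ e ∈ predictionSubmodule L (X₁ * G), eddpcCost Qt Rt Pt e ≤ 0 → e = 0) :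
    MinimizersConverge (relaxedFeasible N ud yd χ₀ U Y) (relaxedCost Q R P)
      (eddpcFeasible X₁ G ξ₀ U X s) (eddpcCost Qt Rt Pt) Φ := by
  have hr : ∀ d : RelaxedVar n m p L N, 0 ≤ d.1 ⬝ᵥ d.1 := fun d =>
    Finset.sum_nonneg fun i _ => mul_self_nonneg _
  have hcost := mul_dotProduct_le_relaxedCost (L := L) (N := N) hQ hR hP
  rw [← coe_eddpcCostForm]
  refine minimizersConverge_of_quadratic (r := fun d => d.1 ⬝ᵥ d.1) (c := c)
    (relaxedCostForm L N Q R P) (coe_relaxedCostForm Q R P) (eddpcCostForm L Qt Rt Pt)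
    h.1 ?_ (fun d _ => hr d) (continuous_relaxedCostForm Q R P) ?_ (hankelSubmodule L N ud yd) ?_
    (isClosed_relaxedFeasible hU hY) (convex_relaxedFeasible hU' hY')
    (fun a ha b hb => sub_mem_hankelSubmodule ha hb) (continuous_eddpcCostForm Qt Rt Pt) ?_
    (predictionSubmodule L (X₁ * G)) ?_ (isClosed_eddpcFeasible hU hX)
    (convex_eddpcFeasible hU' hX') (fun a ha b hb => sub_mem_predictionSubmodule ha hb)
  · rw [coe_eddpcCostForm]
    exact h.2.1
  · intro ρ hρ d
    rw [coe_relaxedCostForm]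
    exact (mul_nonneg hρ.le (hr d)).trans (hcost ρ d)
  · intro ρ hρ d hd hd0
    rw [coe_relaxedCostForm]
    refine (mul_pos hρ ((hr d).lt_of_ne' fun h0 => hd0 ?_)).trans_le (hcost ρ d)
    exact eq_zero_of_mem_hankelSubmodule hd (dotProduct_self_eq_zero.1 h0)
  · rw [coe_eddpcCostForm]
    exact eddpcCost_nonneg hQt hRt hPt
  · intro e he he0
    rw [coe_eddpcCostForm]
    by_contra! hle
    exact he0 (hpos e he hle)

/-! ### The prediction model and prolonged trajectories -/

theorem exists_extend_delayComb {M M' : ℕ} (h : M ≤ M') (a : Fin M → ℝ) :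
    ∃ β : Fin M' → ℝ, ∀ {q : ℕ} (w : ℕ → Fin q → ℝ) (i : ℕ),
      delayComb β w i = delayComb a w i := by
  obtain ⟨r, rfl⟩ := Nat.exists_eq_add_of_le h
  exact ⟨Fin.append a 0, fun w i => delayComb_append_zero a w i⟩

theorem pastStack_congr {m p n : ℕ} {u u' : ℕ → Fin m → ℝ} {y y' : ℕ → Fin p → ℝ} {k k' : ℕ}
    (hu : ∀ i < n, u (k - n + i) = u' (k' - n + i))
    (hy : ∀ i < n, y (k - n + i) = y' (k' - n + i)) :
    pastStack n u y k = pastStack n u' y' k' := by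
  ext (⟨i, l⟩ | ⟨i, l⟩)
  · exact congrFun (hu i i.2) l
  · exact congrFun (hy i i.2) l

section PredictionModel

variable {n m p N₁ : ℕ} {σ : Type}

/-- A generalized inverse of `M` yields the right prediction on the range of `M` as soon as the
data determine the next state, that is `ker M ⊆ ker X₁`; `M` need not have full row rank. -/
theorem shiftedStates_mul_mulVec [Fintype σ] {ud : ℕ → Fin m → ℝ} {ξd : ℕ → σ → ℝ}
    {G : Matrix (Fin N₁) (Fin m ⊕ σ) ℝ} (hG : IsGenInverse (dataMatrix n N₁ ud ξd) G)
    (hker : ∀ β : Fin N₁ → ℝ, delayComb β ud n = 0 → delayComb β ξd n = 0 →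
      delayComb β ξd (n + 1) = 0) (β : Fin N₁ → ℝ) :
    (shiftedStates n N₁ ξd * G).mulVec (Sum.elim (delayComb β ud n) (delayComb β ξd n)) =
      delayComb β ξd (n + 1) := by
  have hM : ∀ β : Fin N₁ → ℝ, (dataMatrix n N₁ ud ξd).mulVec β =
      Sum.elim (delayComb β ud n) (delayComb β ξd n) := by
    intro β
    ext (i | i) <;> simp [dataMatrix, Matrix.mulVec, dotProduct, delayComb, mul_comm]
  have hX : ∀ β : Fin N₁ → ℝ, (shiftedStates n N₁ ξd).mulVec β = delayComb β ξd (n + 1) := by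
    intro β
    ext i
    simp [shiftedStates, Matrix.mulVec, dotProduct, delayComb, mul_comm, add_right_comm]
  have h0 : (dataMatrix n N₁ ud ξd).mulVec
      (G.mulVec ((dataMatrix n N₁ ud ξd).mulVec β) - β) = 0 := by
    rw [Matrix.mulVec_sub, Matrix.mulVec_mulVec, Matrix.mulVec_mulVec, (hG : _ * _ * _ = _),
      sub_self]
  rw [hM (G.mulVec _ - β)] at h0
  have h1 := hker _ (funext fun i => congrFun h0 (Sum.inl i))
    (funext fun i => congrFun h0 (Sum.inr i))
  rw [← hX, Matrix.mulVec_sub, sub_eq_zero, hX β, hM β] at h1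
  rw [← Matrix.mulVec_mulVec, h1]

variable {S : LTISystem n m p} {ud : ℕ → Fin m → ℝ} {xd : ℕ → Fin n → ℝ} {yd : ℕ → Fin p → ℝ}

theorem delayComb_state_eq_zero (hd : S.IsTrajectory (n + N₁) ud xd yd) (β : Fin N₁ → ℝ)
    (hu : delayComb β ud n = 0) (hx : delayComb β xd n = 0) : delayComb β xd (n + 1) = 0 := by
  have h := hd.delayComb β (K' := n + 1) fun _ => by omega
  rw [(h n n.lt_succ_self).1, hu, hx]
  simp

/-- If the past inputs and outputs vanish, then so does the state by observability, and with the
current input also the current output. -/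
theorem delayComb_pastStack_eq_zero (ho : S.Observable)
    (hd : S.IsTrajectory (n + N₁) ud xd yd) (β : Fin N₁ → ℝ)
    (hu : delayComb β ud n = 0) (hz : delayComb β (pastStack n ud yd) n = 0) :
    delayComb β (pastStack n ud yd) (n + 1) = 0 := by
  have h := hd.delayComb β (K' := n + 1) fun _ => by omega
  rw [delayComb_pastStack β ud yd le_rfl] at hz
  have hu0 : ∀ k < n, delayComb β ud k = 0 := fun k hk => funext fun i => by
    simpa [pastStack, stack] using congrFun hz (Sum.inl (⟨k, hk⟩, i))
  have hy0 : ∀ k < n, delayComb β yd k = 0 := fun k hk => funext fun i => by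
    simpa [pastStack, stack] using congrFun hz (Sum.inr (⟨k, hk⟩, i))
  have hx : delayComb β xd n = 0 := ho.state_eq (h.mono n.le_succ)
    (LTISystem.isTrajectory_zero (K := n)) hu0 hy0 n le_rfl
  have hyn : delayComb β yd n = 0 := by
    rw [(h n n.lt_succ_self).2, hu, hx]
    simp
  rw [delayComb_pastStack β ud yd n.le_succ]
  have hu1 : ∀ i : Fin n, delayComb β ud (1 + i) = 0 := fun i => by
    rcases (Nat.one_add_le_iff.2 i.2).lt_or_eq with h1 | h1
    · exact hu0 _ h1
    · rw [h1, hu]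
  have hy1 : ∀ i : Fin n, delayComb β yd (1 + i) = 0 := fun i => by
    rcases (Nat.one_add_le_iff.2 i.2).lt_or_eq with h1 | h1
    · exact hy0 _ h1
    · rw [h1, hyn]
  ext (⟨i, l⟩ | ⟨i, l⟩) <;> simp [pastStack, stack, hu1, hy1]

variable {N L : ℕ}

/-- Every trajectory of length `n + 1` is a combination of those in the data used by E-DDPC. The
coefficients from the fundamental lemma for length `n + L`, extended by zero, combine trajectories
that start at the times `0, …, N - n - L`; their samples at time `n` are the columns of the data
matrix. -/
theorem exists_data_coeff (hn : 1 ≤ n) (hL : n ≤ L) (hN : N ≤ N₁ + n) (hc : S.Controllable)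
    (hd : S.IsTrajectory (n + N₁) ud xd yd) (hpe : PersistentlyExciting N (L + 2 * n) ud)
    {u : ℕ → Fin m → ℝ} {x : ℕ → Fin n → ℝ} {y : ℕ → Fin p → ℝ}
    (h : S.IsTrajectory (n + 1) u x y) :
    ∃ β : Fin N₁ → ℝ, (∀ i < n + 1, delayComb β ud i = u i) ∧
      (∀ i ≤ n + 1, delayComb β xd i = x i) ∧ ∀ i < n + 1, delayComb β yd i = y i := by
  have hpe' : PersistentlyExciting N (n + L + n) ud := by
    rwa [show n + L + n = L + 2 * n by ring]
  obtain ⟨a, h1, h2, h3⟩ := exists_delayComb_eq_trajectory hc hd (by omega) hpe'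
    (K' := n + 1) (by omega) h
  obtain ⟨β, hβ⟩ := exists_extend_delayComb (show N + 1 - (n + L) ≤ N₁ by omega) a
  simp only [← hβ] at h1 h2 h3
  exact ⟨β, h1, h2, h3⟩

theorem prediction_state (hn : 1 ≤ n) (hL : n ≤ L) (hN : N ≤ N₁ + n) (hc : S.Controllable)
    (hd : S.IsTrajectory (n + N₁) ud xd yd) (hpe : PersistentlyExciting N (L + 2 * n) ud)
    {G : Matrix (Fin N₁) (Fin m ⊕ Fin n) ℝ} (hG : IsGenInverse (dataMatrix n N₁ ud xd) G)
    {u : ℕ → Fin m → ℝ} {x : ℕ → Fin n → ℝ} {y : ℕ → Fin p → ℝ}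
    (h : S.IsTrajectory (n + L) u x y) (k : ℕ) (hk : k < L) :
    (shiftedStates n N₁ xd * G).mulVec (Sum.elim (u (n + k)) (x (n + k))) = x (n + k + 1) := by
  obtain ⟨β, h1, h2, -⟩ := exists_data_coeff hn hL hN hc hd hpe
    (h.shift (s := k) (K' := n + 1) (by omega))
  have h3 := shiftedStates_mul_mulVec hG (delayComb_state_eq_zero hd) β
  rw [h1 n n.lt_succ_self, h2 n n.le_succ, h2 (n + 1) le_rfl] at h3
  simpa only [add_comm n k, add_assoc] using h3

theorem prediction_pastStack (hn : 1 ≤ n) (hL : n ≤ L) (hN : N ≤ N₁ + n) (hc : S.Controllable)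
    (ho : S.Observable)
    (hd : S.IsTrajectory (n + N₁) ud xd yd) (hpe : PersistentlyExciting N (L + 2 * n) ud)
    {G : Matrix (Fin N₁) (Fin m ⊕ IOIndex n m p) ℝ}
    (hG : IsGenInverse (dataMatrix n N₁ ud (pastStack n ud yd)) G)
    {u : ℕ → Fin m → ℝ} {x : ℕ → Fin n → ℝ} {y : ℕ → Fin p → ℝ}
    (h : S.IsTrajectory (n + L) u x y) (k : ℕ) (hk : k < L) :
    (shiftedStates n N₁ (pastStack n ud yd) * G).mulVec
      (Sum.elim (u (n + k)) (pastStack n u y (n + k))) = pastStack n u y (n + k + 1) := by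
  obtain ⟨β, h1, -, h2⟩ := exists_data_coeff hn hL hN hc hd hpe
    (h.shift (s := k) (K' := n + 1) (by omega))
  have h3 := shiftedStates_mul_mulVec hG (delayComb_pastStack_eq_zero ho hd) β
  have hidx : ∀ i, n + k - n + i = k + i := fun i => by omega
  have hidx' : ∀ i, n + k + 1 - n + i = k + (1 + i) := fun i => by omega
  have h4 : delayComb β (pastStack n ud yd) n = pastStack n u y (n + k) := by
    rw [delayComb_pastStack β ud yd le_rfl]
    refine pastStack_congr (fun i hi => ?_) fun i hi => ?_
    · rw [Nat.sub_self, zero_add, h1 i (by omega), hidx]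
    · rw [Nat.sub_self, zero_add, h2 i (by omega), hidx]
  have h5 : delayComb β (pastStack n ud yd) (n + 1) = pastStack n u y (n + k + 1) := by
    rw [delayComb_pastStack β ud yd (Nat.le_add_right n 1)]
    refine pastStack_congr (fun i hi => ?_) fun i hi => ?_
    · rw [Nat.add_sub_cancel_left, h1 _ (by omega), hidx']
    · rw [Nat.add_sub_cancel_left, h2 _ (by omega), hidx']
  rwa [h1 n n.lt_succ_self, h4, h5, add_comm k n] at h3

end PredictionModel

section Prolongations

variable {n m p : ℕ}

/-- The trajectory `u', x', y'` of length `n + L` continues the trajectory `u, x, y` of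
length `n`. -/
structure LTISystem.Prolongs (S : LTISystem n m p) (L : ℕ) (u : ℕ → Fin m → ℝ)
    (x : ℕ → Fin n → ℝ) (y : ℕ → Fin p → ℝ) (u' : ℕ → Fin m → ℝ) (x' : ℕ → Fin n → ℝ)
    (y' : ℕ → Fin p → ℝ) : Prop where
  traj : S.IsTrajectory (n + L) u' x' y'
  input_eq : ∀ i < n, u' i = u i
  state_eq : ∀ i ≤ n, x' i = x i
  output_eq : ∀ i < n, y' i = y i

variable {S : LTISystem n m p} {L N N₁ : ℕ} {ud : ℕ → Fin m → ℝ} {xd : ℕ → Fin n → ℝ}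
  {yd : ℕ → Fin p → ℝ} {u u' : ℕ → Fin m → ℝ} {x x' : ℕ → Fin n → ℝ} {y y' : ℕ → Fin p → ℝ}
  {U : Set (Fin m → ℝ)} {Y : Set (Fin p → ℝ)}

theorem LTISystem.Prolongs.pastStack_eq (h : S.Prolongs L u x y u' x' y') :
    pastStack n u' y' n = pastStack n u y n :=
  pastStack_congr (fun i hi => h.input_eq _ (by omega)) fun i hi => h.output_eq _ (by omega)

theorem LTISystem.IsTrajectory.exists_prolongs (h : S.IsTrajectory n u x y)
    (v : Fin L → Fin m → ℝ) :
    ∃ u' x' y', S.Prolongs L u x y u' x' y' ∧ ∀ k : Fin L, u' (n + k) = v k := by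
  let u' : ℕ → Fin m → ℝ := fun t =>
    if t < n then u t else if h : t - n < L then v ⟨t - n, h⟩ else 0
  have hu : ∀ i < n, u' i = u i := fun i hi => if_pos hi
  obtain ⟨x', y', h0, h'⟩ := S.exists_isTrajectory (x 0) u'
  refine ⟨u', x', y', ⟨h' _, hu, (h' n).state_eq h hu h0, (h' n).output_eq h hu h0⟩, fun k => ?_⟩
  simp [u']

/-- Feasible points of the relaxed problem are trajectories that continue the past one: by
observability the past inputs and outputs fix the state. -/
theorem exists_prolongs_of_mem_relaxedFeasible (ho : S.Observable) (hN : N ≤ N₁ + n)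
    (hd : S.IsTrajectory (n + N₁) ud xd yd) (h : S.IsTrajectory n u x y)
    {d : RelaxedVar n m p L N} (hF : d ∈ relaxedFeasible N ud yd (pastStack n u y n) U Y) :
    ∃ u' x' y', S.Prolongs L u x y u' x' y' ∧ (∀ j, d.2.1 j = u' j) ∧ (∀ j, d.2.2 j = y' j) ∧
      ∀ k < L, u' (n + k) ∈ U ∧ y' (n + k) ∈ Y := by
  obtain ⟨h1, h2, h3, h4⟩ := hF
  have hu : ∀ j, d.2.1 j = delayComb d.1 ud j := fun j => funext fun i => by
    rw [h1, hankel_mulVec]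
  have hy : ∀ j, d.2.2 j = delayComb d.1 yd j := fun j => funext fun i => by
    rw [h2, hankel_mulVec]
  have ht := hd.delayComb d.1 (K' := n + L) fun _ => by omega
  have hu0 : ∀ i < n, delayComb d.1 ud i = u i := fun i hi => funext fun l => by
    have h5 := congrFun h3 (Sum.inl (⟨i, hi⟩, l))
    simpa [stack, window, pastStack, hu] using h5
  have hy0 : ∀ i < n, delayComb d.1 yd i = y i := fun i hi => funext fun l => by
    have h5 := congrFun h3 (Sum.inr (⟨i, hi⟩, l))
    simpa [stack, window, pastStack, hy] using h5
  refine ⟨_, _, _, ⟨ht, hu0, ho.state_eq (ht.mono (by omega)) h hu0 hy0, hy0⟩, hu, hy,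
    fun k hk => ?_⟩
  have h5 := h4 ⟨k, hk⟩
  simpa [future, hu, hy] using h5

/-- By the fundamental lemma every trajectory that continues the past one and satisfies the
constraints is feasible for the relaxed problem. -/
theorem LTISystem.Prolongs.exists_mem_relaxedFeasible (hc : S.Controllable) (hN : N ≤ N₁ + n)
    (hd : S.IsTrajectory (n + N₁) ud xd yd) (hpe : PersistentlyExciting N (L + 2 * n) ud)
    (h : S.Prolongs L u x y u' x' y') (hUY : ∀ k < L, u' (n + k) ∈ U ∧ y' (n + k) ∈ Y) :
    ∃ d : RelaxedVar n m p L N, d ∈ relaxedFeasible N ud yd (pastStack n u y n) U Y ∧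
      (∀ j, d.2.1 j = u' j) ∧ ∀ j, d.2.2 j = y' j := by
  have hpe' : PersistentlyExciting N (n + L + n) ud := by
    rwa [show n + L + n = L + 2 * n by ring]
  obtain ⟨a, h1, -, h3⟩ := exists_delayComb_eq_trajectory hc hd (by omega) hpe' le_rfl h.traj
  refine ⟨(a, fun j => u' j, fun j => y' j), ⟨fun j i => ?_, fun j i => ?_, ?_, fun k => ?_⟩,
    fun _ => rfl, fun _ => rfl⟩
  · rw [hankel_mulVec, h1 j j.2]
  · rw [hankel_mulVec, h3 j j.2]
  · rw [← h.pastStack_eq]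
    ext (⟨i, l⟩ | ⟨i, l⟩) <;> simp [stack, window, pastStack]
  · simpa [future] using hUY k k.2

/-- The prediction model of E-DDPC, if it is exact for the states `ξ`, generates trajectories that
continue the past one. -/
theorem LTISystem.IsTrajectory.exists_prolongs_of_prediction {σ : Type} [Fintype σ]
    (h : S.IsTrajectory n u x y) {A : Matrix σ (Fin m ⊕ σ) ℝ}
    (ξ : (ℕ → Fin m → ℝ) → (ℕ → Fin n → ℝ) → (ℕ → Fin p → ℝ) → ℕ → σ → ℝ)
    (hstep : ∀ u' x' y', S.IsTrajectory (n + L) u' x' y' → ∀ k < L,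
      A.mulVec (Sum.elim (u' (n + k)) (ξ u' x' y' (n + k))) = ξ u' x' y' (n + k + 1))
    {e : EDDPCVar m L σ}
    (he : ∀ k : Fin L, e.2 k.succ = A.mulVec (Sum.elim (e.1 k) (e.2 k.castSucc)))
    (he0 : ∀ u' x' y', S.Prolongs L u x y u' x' y' → e.2 0 = ξ u' x' y' n) :
    ∃ u' x' y', S.Prolongs L u x y u' x' y' ∧ (∀ k, e.1 k = u' (n + k)) ∧
      ∀ k, e.2 k = ξ u' x' y' (n + k) := by
  obtain ⟨u', x', y', h', hu⟩ := h.exists_prolongs e.1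
  refine ⟨u', x', y', h', fun k => (hu k).symm, fun k => ?_⟩
  induction k using Fin.induction with
  | zero => exact he0 u' x' y' h'
  | succ k ih =>
    rw [he k, ih, ← hu k, Fin.val_castSucc, hstep u' x' y' h'.traj k k.2, Fin.val_succ, add_assoc]

theorem toMeasured_eq {S : LTISystem n m n} (hC : S.C = 1) (hD : S.D = 0)
    {u' : ℕ → Fin m → ℝ} {x' y' : ℕ → Fin n → ℝ} (h : S.IsTrajectory (n + L) u' x' y')
    {T : Matrix (Fin n) (IOIndex n m n) ℝ}
    (hT : ∀ u' x' y', S.IsTrajectory n u' x' y' → x' n = T.mulVec (pastStack n u' y' n))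
    {d : RelaxedVar n m n L N} (hu : ∀ j, d.2.1 j = u' j) (hy : ∀ j, d.2.2 j = y' j) :
    toMeasured T d = (fun k : Fin L => u' (n + k), fun k : Fin (L + 1) => x' (n + k)) := by
  refine Prod.ext (funext fun k => by simp [toMeasured, future, hu]) (funext fun k => ?_)
  refine Fin.lastCases ?_ (fun k => ?_) k
  · have h1 := hT _ _ _ (h.shift (s := L) (K' := n) (by omega))
    simp only [toMeasured, Fin.snoc_last, Fin.val_last]
    rw [add_comm L n] at h1
    rw [h1]
    congr 1
    ext (⟨i, l⟩ | ⟨i, l⟩) <;> simp [stack, window, pastStack, hu, hy]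
  · have h1 := (h (n + k) (by omega)).2
    rw [hC, hD, Matrix.one_mulVec, Matrix.zero_mulVec, add_zero] at h1
    simp only [toMeasured, Fin.snoc_castSucc, Fin.val_castSucc]
    simp [future, hy, h1]

theorem toNonminimal_eq {d : RelaxedVar n m p L N} (hu : ∀ j, d.2.1 j = u' j)
    (hy : ∀ j, d.2.2 j = y' j) :
    toNonminimal d =
      (fun k : Fin L => u' (n + k), fun k : Fin (L + 1) => pastStack n u' y' (n + k)) := by
  refine Prod.ext (funext fun k => by simp [toNonminimal, future, hu]) (funext fun k => ?_)
  ext (⟨i, l⟩ | ⟨i, l⟩) <;> simp [toNonminimal, stack, window, pastStack, hu, hy]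

end Prolongations

/-! ### The two cases -/

section FullyMeasured

variable {n m L N N₁ : ℕ} {S : LTISystem n m n} {ud : ℕ → Fin m → ℝ} {xd yd : ℕ → Fin n → ℝ}
  {G : Matrix (Fin N₁) (Fin m ⊕ Fin n) ℝ} {u : ℕ → Fin m → ℝ} {x y : ℕ → Fin n → ℝ}
  {T : Matrix (Fin n) (IOIndex n m n) ℝ}

theorem image_toMeasured (hn : 1 ≤ n) (hL : n ≤ L) (hN : N ≤ N₁ + n) (hC : S.C = 1) (hD : S.D = 0)
    (hc : S.Controllable) (ho : S.Observable) (hd : S.IsTrajectory (n + N₁) ud xd yd)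
    (hpe : PersistentlyExciting N (L + 2 * n) ud) (hG : IsGenInverse (dataMatrix n N₁ ud xd) G)
    (h : S.IsTrajectory n u x y) (U : Set (Fin m → ℝ)) (Y : Set (Fin n → ℝ))
    (hT : ∀ u' x' y', S.IsTrajectory n u' x' y' → x' n = T.mulVec (pastStack n u' y' n)) :
    toMeasured T '' relaxedFeasible (L := L) N ud yd (pastStack n u y n) U Y =
      eddpcFeasible (shiftedStates n N₁ xd) G (x n) U Y L := by
  have hyx : ∀ {u' x' y'}, S.IsTrajectory (n + L) u' x' y' → ∀ k < L, y' (n + k) = x' (n + k) := by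
    intro u' x' y' h' k hk
    rw [(h' (n + k) (by omega)).2, hC, hD, Matrix.one_mulVec, Matrix.zero_mulVec, add_zero]
  have hstep := fun u' x' y' (h' : S.IsTrajectory (n + L) u' x' y') =>
    prediction_state hn hL hN hc hd hpe hG h'
  ext e
  constructor
  · rintro ⟨d, hF, rfl⟩
    obtain ⟨u', x', y', h', hu, hy, hUY⟩ := exists_prolongs_of_mem_relaxedFeasible ho hN hd h hF
    rw [toMeasured_eq hC hD h'.traj hT hu hy]
    refine ⟨fun k => ?_, h'.state_eq n le_rfl, fun k => (hUY k k.2).1, fun k hk => ?_⟩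
    · simpa [add_assoc] using (hstep u' x' y' h'.traj k k.2).symm
    · have h1 := (hUY k hk).2
      rwa [hyx h'.traj k hk] at h1
  · rintro ⟨h1, h2, h3, h4⟩
    obtain ⟨u', x', y', h', hu, hx⟩ := h.exists_prolongs_of_prediction (fun _ x' _ => x') hstep h1
      fun u' x' y' h' => by rw [h2, h'.state_eq n le_rfl]
    obtain ⟨d, hF, hu', hy'⟩ := h'.exists_mem_relaxedFeasible hc hN hd hpe (U := U) (Y := Y)
      fun k hk => by
        constructor
        · simpa [hu] using h3 ⟨k, hk⟩
        · have h5 := h4 ⟨k, by omega⟩ hk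
          rw [hyx h'.traj k hk]
          rwa [hx] at h5
    refine ⟨d, hF, ?_⟩
    rw [toMeasured_eq hC hD h'.traj hT hu' hy']
    exact (Prod.ext (funext hu) (funext hx)).symm

theorem eddpcCost_toMeasured (Q : Matrix (Fin n) (Fin n) ℝ) (R : Matrix (Fin m) (Fin m) ℝ)
    (Pt : Matrix (Fin n) (Fin n) ℝ) (ρ : ℝ) (d : RelaxedVar n m n L N) :
    relaxedCost Q R (T.transpose * Pt * T) ρ d =
      eddpcCost Q R Pt (toMeasured T d) + 0 + ρ * (d.1 ⬝ᵥ d.1) := by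
  simp [relaxedCost, eddpcCost, toMeasured, wsq_transpose_mul_mul]

end FullyMeasured

section OutputMeasured

variable {n m p L N N₁ : ℕ} {S : LTISystem n m p} {ud : ℕ → Fin m → ℝ} {xd : ℕ → Fin n → ℝ}
  {yd : ℕ → Fin p → ℝ} {G : Matrix (Fin N₁) (Fin m ⊕ IOIndex n m p) ℝ}
  {u : ℕ → Fin m → ℝ} {x : ℕ → Fin n → ℝ} {y : ℕ → Fin p → ℝ}
  {V : Matrix (Fin m ⊕ Fin p) (IOIndex n m p) ℝ}

theorem LTISystem.Prolongs.pastStack_mem_stackSet {u' : ℕ → Fin m → ℝ} {x' : ℕ → Fin n → ℝ}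
    {y' : ℕ → Fin p → ℝ} (h : S.Prolongs L u x y u' x' y') {U : Set (Fin m → ℝ)}
    {Y : Set (Fin p → ℝ)} (hχ : pastStack n u y n ∈ stackSet n U Y)
    (hUY : ∀ k < L, u' (n + k) ∈ U ∧ y' (n + k) ∈ Y) (k : Fin (L + 1)) :
    pastStack n u' y' (n + k) ∈ stackSet n U Y := by
  rw [← h.pastStack_eq] at hχ
  have hu : ∀ i < n + L, u' i ∈ U := by
    intro i hi
    rcases lt_or_ge i n with h1 | h1
    · simpa [pastStack, stack] using hχ.1 ⟨i, h1⟩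
    · have h2 := (hUY (i - n) (by omega)).1
      rwa [Nat.add_sub_cancel' h1] at h2
  have hy : ∀ i < n + L, y' i ∈ Y := by
    intro i hi
    rcases lt_or_ge i n with h1 | h1
    · simpa [pastStack, stack] using hχ.2 ⟨i, h1⟩
    · have h2 := (hUY (i - n) (by omega)).2
      rwa [Nat.add_sub_cancel' h1] at h2
  exact ⟨fun i => hu (n + k - n + i) (by omega), fun i => hy (n + k - n + i) (by omega)⟩

theorem image_toNonminimal (hn : 1 ≤ n) (hL : n ≤ L) (hN : N ≤ N₁ + n)
    (hc : S.Controllable) (ho : S.Observable) (hd : S.IsTrajectory (n + N₁) ud xd yd)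
    (hpe : PersistentlyExciting N (L + 2 * n) ud)
    (hG : IsGenInverse (dataMatrix n N₁ ud (pastStack n ud yd)) G)
    (h : S.IsTrajectory n u x y) (U : Set (Fin m → ℝ)) (Y : Set (Fin p → ℝ))
    (hχ : pastStack n u y n ∈ stackSet n U Y) :
    toNonminimal '' relaxedFeasible (L := L) N ud yd (pastStack n u y n) U Y =
      eddpcFeasible (shiftedStates n N₁ (pastStack n ud yd)) G (pastStack n u y n)
        U (stackSet n U Y) (L + 1) := by
  have hstep := fun u' x' y' (h' : S.IsTrajectory (n + L) u' x' y') =>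
    prediction_pastStack hn hL hN hc ho hd hpe hG h'
  ext e
  constructor
  · rintro ⟨d, hF, rfl⟩
    obtain ⟨u', x', y', h', hu, hy, hUY⟩ := exists_prolongs_of_mem_relaxedFeasible ho hN hd h hF
    rw [toNonminimal_eq hu hy]
    refine ⟨fun k => ?_, h'.pastStack_eq, fun k => (hUY k k.2).1, fun k _ =>
      h'.pastStack_mem_stackSet hχ hUY k⟩
    simpa [add_assoc] using (hstep u' x' y' h'.traj k k.2).symm
  · rintro ⟨h1, h2, h3, h4⟩
    obtain ⟨u', x', y', h', hu, hx⟩ := h.exists_prolongs_of_prediction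
      (fun u' _ y' => pastStack n u' y') hstep h1 fun u' x' y' h' => by rw [h2, h'.pastStack_eq]
    obtain ⟨d, hF, hu', hy'⟩ := h'.exists_mem_relaxedFeasible hc hN hd hpe (U := U) (Y := Y)
      fun k hk => by
        refine ⟨by simpa [hu] using h3 ⟨k, hk⟩, ?_⟩
        -- The output at time `k` is the last one in the stack at time `k + 1`.
        have h5 := (h4 ⟨k + 1, by omega⟩ (by simpa using hk)).2 ⟨n - 1, by omega⟩
        have hidx : k + 1 + (n - 1) = n + k := by omega
        simpa [hx, pastStack, stack, hidx] using h5
    refine ⟨d, hF, ?_⟩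
    rw [toNonminimal_eq hu' hy']
    exact (Prod.ext (funext hu) (funext hx)).symm

theorem mulVec_pastStack_eq (hn : 1 ≤ n)
    (hV : ∀ u' x' y', S.IsTrajectory n u' x' y' →
      Sum.elim (u' (n - 1)) (y' (n - 1)) = V.mulVec (pastStack n u' y' n))
    {u' : ℕ → Fin m → ℝ} {x' : ℕ → Fin n → ℝ} {y' : ℕ → Fin p → ℝ}
    (h : S.IsTrajectory (n + L) u' x' y') {k : ℕ} (hk : k ≤ L) :
    V.mulVec (pastStack n u' y' (n + k)) = Sum.elim (u' (n + k - 1)) (y' (n + k - 1)) := by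
  have h1 := hV _ _ _ (h.shift (s := k) (K' := n) (by omega))
  have h2 : pastStack n (fun i => u' (k + i)) (fun i => y' (k + i)) n =
      pastStack n u' y' (n + k) :=
    pastStack_congr (fun i _ => by simp) fun i _ => by simp
  have h3 : k + (n - 1) = n + k - 1 := by omega
  rw [h2] at h1
  rw [← h1, h3]

theorem wsq_pastStack_eq (hn : 1 ≤ n)
    (hV : ∀ u' x' y', S.IsTrajectory n u' x' y' →
      Sum.elim (u' (n - 1)) (y' (n - 1)) = V.mulVec (pastStack n u' y' n))
    {u' : ℕ → Fin m → ℝ} {x' : ℕ → Fin n → ℝ} {y' : ℕ → Fin p → ℝ}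
    (h : S.IsTrajectory (n + L) u' x' y') (Q : Matrix (Fin p) (Fin p) ℝ)
    (R : Matrix (Fin m) (Fin m) ℝ) {k : ℕ} (hk : k ≤ L) :
    wsq (V.transpose * Matrix.fromBlocks R 0 0 Q * V) (pastStack n u' y' (n + k)) =
      wsq R (u' (n + k - 1)) + wsq Q (y' (n + k - 1)) := by
  rw [wsq_transpose_mul_mul, mulVec_pastStack_eq hn hV h hk, wsq_fromBlocks_diagonal]
  simp only [Sum.elim_inl, Sum.elim_inr]

/-- The stage cost of `z_k` is that of the input and output at time `k - 1`. The sums therefore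
differ by the cost at time `-1`, once the stage cost of `z_L` is moved into the terminal weight. -/
theorem eddpcCost_toNonminimal (hn : 1 ≤ n) (ho : S.Observable) (hN : N ≤ N₁ + n)
    (hd : S.IsTrajectory (n + N₁) ud xd yd) (h : S.IsTrajectory n u x y)
    {U : Set (Fin m → ℝ)} {Y : Set (Fin p → ℝ)}
    (hV : ∀ u' x' y', S.IsTrajectory n u' x' y' →
      Sum.elim (u' (n - 1)) (y' (n - 1)) = V.mulVec (pastStack n u' y' n))
    (Q : Matrix (Fin p) (Fin p) ℝ) (R : Matrix (Fin m) (Fin m) ℝ)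
    (P : Matrix (IOIndex n m p) (IOIndex n m p) ℝ) (ρ : ℝ) {d : RelaxedVar n m p L N}
    (hF : d ∈ relaxedFeasible N ud yd (pastStack n u y n) U Y) :
    relaxedCost Q R P ρ d =
      eddpcCost (V.transpose * Matrix.fromBlocks R 0 0 Q * V) 0
        (P + V.transpose * Matrix.fromBlocks R 0 0 Q * V) (toNonminimal d) +
        -(wsq R (u (n - 1)) + wsq Q (y (n - 1))) + ρ * (d.1 ⬝ᵥ d.1) := by
  obtain ⟨u', x', y', h', hu, hy, -⟩ := exists_prolongs_of_mem_relaxedFeasible ho hN hd h hF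
  have hlast : stack (window d.2.1 (Fin.last L)) (window d.2.2 (Fin.last L)) =
      pastStack n u' y' (n + L) := congrFun (congrArg Prod.snd (toNonminimal_eq hu hy)) (Fin.last L)
  have hsum := Finset.sum_range_succ' (fun k => wsq R (u' (n + k - 1)) + wsq Q (y' (n + k - 1))) L
  have h0 : wsq R (u' (n + 0 - 1)) + wsq Q (y' (n + 0 - 1)) =
      wsq R (u (n - 1)) + wsq Q (y (n - 1)) := by
    rw [add_zero, h'.input_eq _ (by omega), h'.output_eq _ (by omega)]
  have hleft : ∑ k : Fin L, (wsq Q (future d.2.2 k) + wsq R (future d.2.1 k)) =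
      ∑ k ∈ Finset.range L, (wsq R (u' (n + (k + 1) - 1)) + wsq Q (y' (n + (k + 1) - 1))) := by
    rw [← Fin.sum_univ_eq_sum_range
      (fun k => wsq R (u' (n + (k + 1) - 1)) + wsq Q (y' (n + (k + 1) - 1)))]
    refine Finset.sum_congr rfl fun k _ => ?_
    have hk : n + ((k : ℕ) + 1) - 1 = n + k := by omega
    simp only [future, hu, hy, hk, Fin.val_natAdd]
    ring
  have hright : ∑ k : Fin L, wsq (V.transpose * Matrix.fromBlocks R 0 0 Q * V)
      (pastStack n u' y' (n + k)) =
      ∑ k ∈ Finset.range L, (wsq R (u' (n + k - 1)) + wsq Q (y' (n + k - 1))) := by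
    rw [← Fin.sum_univ_eq_sum_range (fun k => wsq R (u' (n + k - 1)) + wsq Q (y' (n + k - 1)))]
    exact Finset.sum_congr rfl fun k _ => wsq_pastStack_eq hn hV h'.traj Q R k.2.le
  rw [Finset.sum_range_succ, h0, ← hleft] at hsum
  rw [toNonminimal_eq hu hy, relaxedCost, eddpcCost, hlast]
  simp only [wsq_zero_left, add_zero, Fin.val_castSucc, Fin.val_last, wsq_add_left]
  rw [hright, wsq_pastStack_eq hn hV h'.traj Q R le_rfl]
  linarith

/-- Although the input weight of E-DDPC is zero, its cost is positive definite on homogeneous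
predictions: these are trajectories that start from zero, and the weights on the states
`z_1, …, z_L` contain those on the inputs. -/
theorem eq_zero_of_eddpcCost_nonpos_nonminimal (hn : 1 ≤ n) (hL : n ≤ L) (hN : N ≤ N₁ + n)
    (hc : S.Controllable) (ho : S.Observable) (hd : S.IsTrajectory (n + N₁) ud xd yd)
    (hpe : PersistentlyExciting N (L + 2 * n) ud)
    (hG : IsGenInverse (dataMatrix n N₁ ud (pastStack n ud yd)) G)
    (hV : ∀ u' x' y', S.IsTrajectory n u' x' y' →
      Sum.elim (u' (n - 1)) (y' (n - 1)) = V.mulVec (pastStack n u' y' n))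
    {Q : Matrix (Fin p) (Fin p) ℝ} (hQ : Q.PosSemidef) {R : Matrix (Fin m) (Fin m) ℝ}
    (hR : R.PosDef) {P : Matrix (IOIndex n m p) (IOIndex n m p) ℝ} (hP : P.PosSemidef)
    (hQt : (V.transpose * Matrix.fromBlocks R 0 0 Q * V).PosSemidef)
    {e : EDDPCVar m L (IOIndex n m p)}
    (he : e ∈ predictionSubmodule L (shiftedStates n N₁ (pastStack n ud yd) * G))
    (hle : eddpcCost (V.transpose * Matrix.fromBlocks R 0 0 Q * V) 0
      (P + V.transpose * Matrix.fromBlocks R 0 0 Q * V) e ≤ 0) : e = 0 := by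
  have h0 : pastStack n (0 : ℕ → Fin m → ℝ) (0 : ℕ → Fin p → ℝ) n = 0 := by
    ext (i | i) <;> rfl
  obtain ⟨u', x', y', h', hu, hz⟩ :=
    (LTISystem.isTrajectory_zero (S := S) (K := n)).exists_prolongs_of_prediction
      (fun u' _ y' => pastStack n u' y')
      (fun u' x' y' h' => prediction_pastStack hn hL hN hc ho hd hpe hG h') he.1
      fun u' x' y' h' => by rw [h'.pastStack_eq, h0, he.2]
  obtain ⟨h1, h2⟩ := wsq_nonpos_of_eddpcCost_nonpos hQt Matrix.PosSemidef.zero (hP.add hQt) hle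
  have h3 : ∀ k : Fin (L + 1), wsq (V.transpose * Matrix.fromBlocks R 0 0 Q * V) (e.2 k) ≤ 0 := by
    intro k
    refine Fin.lastCases ?_ (fun k => (h1 k).1) k
    rw [wsq_add_left] at h2
    have h4 := wsq_nonneg hP (e.2 (Fin.last L))
    linarith
  refine eq_zero_of_mem_predictionSubmodule he fun k => ?_
  have h4 := h3 k.succ
  rw [hz, wsq_pastStack_eq hn hV h'.traj Q R (Nat.lt_succ_iff.1 k.succ.2)] at h4
  have h5 := wsq_nonneg hQ (y' (n + (k.succ : ℕ) - 1))
  have h6 : u' (n + (k.succ : ℕ) - 1) = 0 := eq_zero_of_wsq_nonpos hR (by linarith)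
  have hidx : n + (k.succ : ℕ) - 1 = n + k := by rw [Fin.val_succ]; omega
  rw [hu k, ← hidx, h6]

end OutputMeasured

theorem Matrix.PosSemidef.fromBlocks_diagonal {ι κ : Type*} [Fintype ι] [Fintype κ]
    {R : Matrix ι ι ℝ} {Q : Matrix κ κ ℝ} (hR : R.PosSemidef) (hQ : Q.PosSemidef) :
    (Matrix.fromBlocks R 0 0 Q).PosSemidef := by
  refine Matrix.PosSemidef.of_dotProduct_mulVec_nonneg
    (Matrix.IsHermitian.fromBlocks hR.isHermitian (by simp) hQ.isHermitian) fun v => ?_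
  have h := wsq_fromBlocks_diagonal R Q v
  rw [wsq] at h
  rw [star_trivial, h]
  exact add_nonneg (wsq_nonneg hR _) (wsq_nonneg hQ _)

theorem Matrix.PosSemidef.transpose_mul_mul {ι κ : Type*} [Fintype ι] [Fintype κ]
    {W : Matrix κ κ ℝ} (hW : W.PosSemidef) (T : Matrix κ ι ℝ) :
    (T.transpose * W * T).PosSemidef := by
  simpa using hW.conjTranspose_mul_mul_same T

theorem theorem3 (n m L N N₁ : ℕ) (hn : 1 ≤ n) (hL : n ≤ L) (hN : N ≤ N₁ + n) :
    -- (i) the state is fully measured, so that the output is the state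
    (∀ (S : LTISystem n m n) (_ : S.C = 1) (_ : S.D = 0)
        (_ : S.Controllable) (_ : S.Observable)
        -- data
        (ud : ℕ → Fin m → ℝ) (xd yd : ℕ → Fin n → ℝ) (_ : S.IsTrajectory (n + N₁) ud xd yd)
        (_ : PersistentlyExciting N (L + 2 * n) ud)
        (G : Matrix (Fin N₁) (Fin m ⊕ Fin n) ℝ) (_ : IsGenInverse (dataMatrix n N₁ ud xd) G)
        -- the last `n` samples of the plant before the prediction, and the current state `x_n`
        (u : ℕ → Fin m → ℝ) (x y : ℕ → Fin n → ℝ) (_ : S.IsTrajectory n u x y)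
        -- value constraints
        (U : Set (Fin m → ℝ)) (_ : IsClosed U) (_ : Convex ℝ U)
        (Y : Set (Fin n → ℝ)) (_ : IsClosed Y) (_ : Convex ℝ Y)
        -- weights
        (Q : Matrix (Fin n) (Fin n) ℝ) (_ : Q.PosSemidef)
        (R : Matrix (Fin m) (Fin m) ℝ) (_ : R.PosDef)
        (Pt : Matrix (Fin n) (Fin n) ℝ)
        (T : Matrix (Fin n) (IOIndex n m n) ℝ)
        (_ : ∀ u' x' y', S.IsTrajectory n u' x' y' → x' n = T.mulVec (pastStack n u' y' n))
        (F : Set (RelaxedVar n m n L N)) (_ : F = relaxedFeasible N ud yd (pastStack n u y n) U Y)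
        (J : ℝ → RelaxedVar n m n L N → ℝ) (_ : J = relaxedCost Q R (T.transpose * Pt * T))
        (F' : Set (EDDPCVar m L (Fin n)))
        (_ : F' = eddpcFeasible (shiftedStates n N₁ xd) G (x n) U Y L)
        (J' : EDDPCVar m L (Fin n) → ℝ) (_ : J' = eddpcCost Q R Pt),
      VanishingEquivalent F J (fun d => d.1 ⬝ᵥ d.1) F' J' (toMeasured T) 0 ∧
      (Pt.PosSemidef → MinimizersConverge F J F' J' (toMeasured T))) ∧
    -- (ii) only inputs and outputs are measured
    (∀ (p : ℕ) (S : LTISystem n m p) (_ : S.Controllable) (_ : S.Observable)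
        (ud : ℕ → Fin m → ℝ) (xd : ℕ → Fin n → ℝ) (yd : ℕ → Fin p → ℝ)
        (_ : S.IsTrajectory (n + N₁) ud xd yd)
        (_ : PersistentlyExciting N (L + 2 * n) ud)
        (G : Matrix (Fin N₁) (Fin m ⊕ IOIndex n m p) ℝ)
        (_ : IsGenInverse (dataMatrix n N₁ ud (pastStack n ud yd)) G)
        (u : ℕ → Fin m → ℝ) (x : ℕ → Fin n → ℝ) (y : ℕ → Fin p → ℝ)
        (_ : S.IsTrajectory n u x y)
        (U : Set (Fin m → ℝ)) (_ : IsClosed U) (_ : Convex ℝ U)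
        (Y : Set (Fin p → ℝ)) (_ : IsClosed Y) (_ : Convex ℝ Y)
        -- the past samples satisfy the value constraints
        (_ : pastStack n u y n ∈ stackSet n U Y)
        (Q : Matrix (Fin p) (Fin p) ℝ) (_ : Q.PosSemidef)
        (R : Matrix (Fin m) (Fin m) ℝ) (_ : R.PosDef)
        (P : Matrix (IOIndex n m p) (IOIndex n m p) ℝ)
        (V : Matrix (Fin m ⊕ Fin p) (IOIndex n m p) ℝ)
        (_ : ∀ u' x' y', S.IsTrajectory n u' x' y' →
          Sum.elim (u' (n - 1)) (y' (n - 1)) = V.mulVec (pastStack n u' y' n))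
        (Qt Pt : Matrix (IOIndex n m p) (IOIndex n m p) ℝ) (Rt : Matrix (Fin m) (Fin m) ℝ)
        (_ : Qt = V.transpose * Matrix.fromBlocks R 0 0 Q * V) (_ : Rt = 0) (_ : Pt = P + Qt)
        (F : Set (RelaxedVar n m p L N)) (_ : F = relaxedFeasible N ud yd (pastStack n u y n) U Y)
        (J : ℝ → RelaxedVar n m p L N → ℝ) (_ : J = relaxedCost Q R P)
        (F' : Set (EDDPCVar m L (IOIndex n m p)))
        (_ : F' = eddpcFeasible (shiftedStates n N₁ (pastStack n ud yd)) G (pastStack n u y n)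
          U (stackSet n U Y) (L + 1))
        (J' : EDDPCVar m L (IOIndex n m p) → ℝ) (_ : J' = eddpcCost Qt Rt Pt),
      VanishingEquivalent F J (fun d => d.1 ⬝ᵥ d.1) F' J' toNonminimal
        (-(wsq R (u (n - 1)) + wsq Q (y (n - 1)))) ∧
      (P.PosSemidef → MinimizersConverge F J F' J' toNonminimal)) := by
  have hr : ∀ {k : ℕ} (a : Fin k → ℝ), 0 ≤ a ⬝ᵥ a := fun a =>
    Finset.sum_nonneg fun i _ => mul_self_nonneg _
  constructor
  · rintro S hC hD hc ho ud xd yd hd hpe G hG u x y h U hU hU' Y hY hY' Q hQ R hR Pt T hT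
      _ rfl _ rfl _ rfl _ rfl
    have heq := vanishingEquivalent_of_cost (r := fun d : RelaxedVar n m n L N => d.1 ⬝ᵥ d.1)
      (image_toMeasured (N := N) hn hL hN hC hD hc ho hd hpe hG h U Y hT)
      (fun ρ d _ => eddpcCost_toMeasured Q R Pt ρ d) fun d _ => hr d.1
    refine ⟨heq, fun hPt => minimizersConverge_eddpc hU hU' hY hY' hY hY' hQ hR.posSemidef
      (hPt.transpose_mul_mul T) hQ hR.posSemidef hPt heq fun e he hle => ?_⟩
    have h1 := (wsq_nonpos_of_eddpcCost_nonpos hQ hR.posSemidef hPt hle).1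
    exact eq_zero_of_mem_predictionSubmodule he fun k => eq_zero_of_wsq_nonpos hR (h1 k).2
  · rintro p S hc ho ud xd yd hd hpe G hG u x y h U hU hU' Y hY hY' hχ Q hQ R hR P V hV
      _ _ _ rfl rfl rfl _ rfl _ rfl _ rfl _ rfl
    have heq := vanishingEquivalent_of_cost (r := fun d : RelaxedVar n m p L N => d.1 ⬝ᵥ d.1)
      (image_toNonminimal hn hL hN hc ho hd hpe hG h U Y hχ)
      (fun ρ d hF => eddpcCost_toNonminimal hn ho hN hd h hV Q R P ρ hF) fun d _ => hr d.1
    have hQt := (hR.posSemidef.fromBlocks_diagonal hQ).transpose_mul_mul V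
    exact ⟨heq, fun hP => minimizersConverge_eddpc hU hU' hY hY' (isClosed_stackSet hU hY)
      (convex_stackSet hU' hY') hQ hR.posSemidef hP hQt Matrix.PosSemidef.zero (hP.add hQt) heq
      fun e he hle => eq_zero_of_eddpcCost_nonpos_nonminimal hn hL hN hc ho hd hpe hG hV hQ hR hP
        hQt he hle⟩
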